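/- **Conventions.** For a right-continuous function $f:[0,1]\to\mathbb R$ with left limits (càdlàg), set $f(0-)=0$ and $\Delta_t=f(t)-f(t-)$ (so $\Delta_0=f(0)$). An *excursion* is a càdlàg function $f:[0,1]\to[0,\infty)$ with $f(1)=0$ and $\Delta_t\ge 0$ for all $t\in[0,1]$. For an excursion $f$ and $s,t\in[0,1]$, write $s\preceq t$ if $s\le t$ and $f(s-)\le\inf_{[s,t]}f$, write $s\prec t$ if moreover $s\ne t$, let $s\wedge t$ be the most recent common ancestor of $s$ and $t$ for the partial order $\preceq$, and put $$x_s^t=\mathbf 1_{s\le t}\max\Big(\inf_{[s,t]}f-f(s-),0\Big),\qquad \delta_t(a,b)=\min(|a-b|,\Delta_t-|a-b|)\quad(a,b\in[0,\Delta_t]).$$ The excursion $f$ is *PJG* (pure jump growth) if $f(t)=\sum_{r\preceq t}x_r^t$ for all $t\in[0,1]$. The *looptree* $\mathcal L[f]$ is the quotient of $[0,1]$ by the continuous pseudo-distance $$d(s,t)=\delta_{s\wedge t}(x_{s\wedge t}^s,x_{s\wedge t}^t)+\sum_{s\wedge t\prec r\preceq s}\delta_r(0,x_r^s)+\sum_{s\wedge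 t\prec r\preceq t}\delta_r(0,x_r^t),$$ with the induced distance, rooted at the class of $1$ and endowed with the image of Lebesgue measure on $[0,1]$. For a (finite, rooted) plane tree $\tau$, let $\#\tau$ be its number of vertices, $|\tau|$ its height, $k_u$ the number of children of a vertex $u$, and $u(0)<\dots<u(\#\tau-1)$ its vertices in lexicographic (depth-first) order. Its Łukasiewicz walk is $L_0(\tau)=0$, $L_{i+1}(\tau)=L_i(\tau)+k_{u(i)}-1$ for $0\le i<\#\tau$. The discrete looptree $\mathsf{Loop}(\tau)$ is the graph on the vertices of $\tau$ whose edges join consecutive siblings, each vertex that has children to its first child and to its last child (two edges if it has only one child), and each leaf to itself; it is endowed with the graph distance, the root of $\tau$ as distinguished point, and the uniform probability measure on the vertices. For $c>0$, $c\cdot X$ is the space $X$ with all distances multiplied by $c$. For càdlàg $g$, let $\Theta g(t)=\mathbf 1_{2t\ge1}\,g(2t-1)$. One says that $g_n\to g$ for the *relaxed Skorokhod topology* if $\rho(\Theta g_n,\Theta g)\to0$, where $\rho(g,h)=\inf_\lambda\max(\|\lambda-\mathrm{id}\|_\infty,\|g-h\circ\lambda\|_\infty)$, the infimum being over increasing bijections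 $\lambda$ of $[0,1]$. The *pointed Gromov–Hausdorff–Prokhorov* topology on compact metric spaces with a root and a Borel probability measure is the one given by $$d_{\mathrm{GHP}}^\bullet\big((X_1,d_1,a_1,\mu_1),(X_2,d_2,a_2,\mu_2)\big)=\inf_{\mathcal R,\nu}\max\big(\tfrac12\mathrm{dis}(\mathcal R),\,1-\nu(\mathcal R)\big),$$ where $\nu$ ranges over couplings of $\mu_1,\mu_2$, $\mathcal R$ over compact subsets of $X_1\times X_2$ that contain $(a_1,a_2)$ and project onto both factors, and $\mathrm{dis}(\mathcal R)=\sup\{|d_1(x_1,y_1)-d_2(x_2,y_2)|:(x_1,x_2),(y_1,y_2)\in\mathcal R\}$. **Theorem.** Let $(\tau_n)$ be a sequence of plane trees, let $f$ be an excursion, and let $(a_n)$ be a sequence of positive real numbers tending to $\infty$, such that $|\tau_n|/a_n\to0$ and $\big(a_n^{-1}L_{\lfloor t\#\tau_n\rfloor}(\tau_n)\big)_{t\in[0,1]}\to f$ for the relaxed Skorokhod topology. If $f$ is a PJG excursion, then $$\frac1{a_n}\cdot\mathsf{Loop}(\tau_n)\longrightarrow\mathcal L[f]$$ for the pointed Gromov–Hausdorff–Prokhorov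 topology. -/

import Mathlib

open Filter Topology MeasureTheory
open scoped ENNReal

noncomputable section

namespace LoopTree

/-! ### Excursions, genealogy and the looptree pseudo-distance -/

/-- Right-continuous functions on `[0,1]` with left limits. -/
structure IsCadlag (f : unitInterval → ℝ) : Prop where
  rightCts : ∀ t, ContinuousWithinAt f (Set.Ici t) t
  exists_left : ∀ t, ∃ l, Tendsto f (𝓝[<] t) (𝓝 l)

/-- The left limit `f(t-)`, with the convention `f(0-) = 0`. -/
def leftVal (f : unitInterval → ℝ) (t : unitInterval) : ℝ :=
  if t = 0 then 0 else Function.leftLim f t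

/-- The jump `Δ_t = f(t) - f(t-)`; in particular `Δ_0 = f(0)`. -/
def jump (f : unitInterval → ℝ) (t : unitInterval) : ℝ := f t - leftVal f t

/-- Non-negative càdlàg functions on `[0,1]` with `f(1) = 0` and without negative jumps. -/
structure IsExcursion (f : unitInterval → ℝ) : Prop extends IsCadlag f where
  nonneg : ∀ t, 0 ≤ f t
  map_one : f 1 = 0
  jump_nonneg : ∀ t, 0 ≤ jump f t

/-- `inf_{[s,t]} f`. -/
def infOn (f : unitInterval → ℝ) (s t : unitInterval) : ℝ := sInf (f '' Set.Icc s t)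

/-- The genealogy `s ⪯ t` coded by `f`. -/
def Anc (f : unitInterval → ℝ) (s t : unitInterval) : Prop := s ≤ t ∧ leftVal f s ≤ infOn f s t

/-- `x_s^t = 1_{s ≤ t} max(inf_{[s,t]} f - f(s-), 0)`. -/
def relPos (f : unitInterval → ℝ) (s t : unitInterval) : ℝ :=
  if s ≤ t then max (infOn f s t - leftVal f s) 0 else 0

/-- The most recent common ancestor `s ∧ t`, i.e. the last common ancestor of `s` and `t`. -/
def meet (f : unitInterval → ℝ) (s t : unitInterval) : unitInterval :=
  sSup {r | Anc f r s ∧ Anc f r t}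

/-- The distance `δ_t(a,b) = min(|a-b|, Δ_t-|a-b|)` on `[0,Δ_t]`, a circle of length `Δ_t`. -/
def circleDist (f : unitInterval → ℝ) (t : unitInterval) (a b : ℝ) : ℝ :=
  min |a - b| (jump f t - |a - b|)

/-- `∑_{s ≺ r ⪯ t} δ_r(0, x_r^t)`, for an ancestor `s` of `t`. -/
def lineDist (f : unitInterval → ℝ) (s t : unitInterval) : ℝ :=
  ∑' r : {r : unitInterval // (Anc f s r ∧ s ≠ r) ∧ Anc f r t}, circleDist f r 0 (relPos f r t)

/-- The looptree pseudo-distance coded by `f`. -/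
def loopDist (f : unitInterval → ℝ) (s t : unitInterval) : ℝ :=
  circleDist f (meet f s t) (relPos f (meet f s t) s) (relPos f (meet f s t) t)
    + lineDist f (meet f s t) s + lineDist f (meet f s t) t

/-- Pure jump growth: `f(t) = ∑_{r ⪯ t} x_r^t` for all `t`. -/
def IsPJG (f : unitInterval → ℝ) : Prop :=
  ∀ t, HasSum (fun r : {r : unitInterval // Anc f r t} => relPos f r t) (f t)

/-! ### The looptree function is a continuous pseudo-distance -/

theorem IsCadlag.tendsto_leftVal {f : unitInterval → ℝ} (hf : IsCadlag f) {t : unitInterval}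
    (ht : 0 < t) : (𝓝[<] t).NeBot ∧ Tendsto f (𝓝[<] t) (𝓝 (leftVal f t)) := by
  have hn : (𝓝[<] t).NeBot := nhdsLT_neBot_of_exists_lt ⟨0, ht⟩
  obtain ⟨l, hl⟩ := hf.exists_left t
  refine ⟨hn, ?_⟩
  rw [leftVal, if_neg ht.ne', leftLim_eq_of_tendsto hl]
  exact hl

namespace IsExcursion

variable {f : unitInterval → ℝ}

theorem leftVal_le (hf : IsExcursion f) (t : unitInterval) : leftVal f t ≤ f t := sub_nonneg.1 (hf.jump_nonneg t)

theorem infOn_le (hf : IsExcursion f) {s t u : unitInterval} (h1 : s ≤ u) (h2 : u ≤ t) : infOn f s t ≤ f u :=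
  csInf_le ⟨0, by rintro _ ⟨v, _, rfl⟩; exact hf.nonneg v⟩ ⟨u, ⟨h1, h2⟩, rfl⟩

theorem le_infOn {s t : unitInterval} {c : ℝ} (h : s ≤ t)
    (hc : ∀ u, s ≤ u → u ≤ t → c ≤ f u) : c ≤ infOn f s t :=
  le_csInf ⟨f s, s, ⟨le_rfl, h⟩, rfl⟩ (by rintro _ ⟨v, hv, rfl⟩; exact hc v hv.1 hv.2)

theorem infOn_mono (hf : IsExcursion f) {s t s' t' : unitInterval} (h : s ≤ t) (h1 : s' ≤ s) (h2 : t ≤ t') :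
    infOn f s' t' ≤ infOn f s t :=
  le_infOn h fun _ hu hu' => hf.infOn_le (h1.trans hu) (hu'.trans h2)

theorem infOn_self (hf : IsExcursion f) (t : unitInterval) : infOn f t t = f t :=
  le_antisymm (hf.infOn_le le_rfl le_rfl)
    (le_infOn le_rfl fun u h1 h2 => by rw [le_antisymm h1 h2])

theorem le_leftVal (hf : IsExcursion f) {r t : unitInterval} {c : ℝ} (h : r < t)
    (hc : ∀ u, r < u → u < t → c ≤ f u) : c ≤ leftVal f t := by
  obtain ⟨hn, ht⟩ := hf.tendsto_leftVal (lt_of_le_of_lt unitInterval.nonneg' h)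
  refine ge_of_tendsto ht ?_
  filter_upwards [Ioo_mem_nhdsLT h] with u hu using hc u hu.1 hu.2

theorem infOn_le_leftVal (hf : IsExcursion f) {r t : unitInterval} (h : r < t) : infOn f r t ≤ leftVal f t :=
  hf.le_leftVal h fun _ hu hu' => hf.infOn_le hu.le hu'.le

theorem leftVal_nonneg (hf : IsExcursion f) (t : unitInterval) : 0 ≤ leftVal f t := by
  rcases eq_or_lt_of_le (unitInterval.nonneg' (t := t)) with h | h
  · simp [leftVal, ← h]
  · exact hf.le_leftVal h fun u _ _ => hf.nonneg u

theorem infOn_split (hf : IsExcursion f) {r m t : unitInterval} (h1 : r ≤ m) (h2 : m ≤ t) :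
    infOn f r t = min (infOn f r m) (infOn f m t) := by
  refine le_antisymm (le_min (hf.infOn_mono h1 le_rfl h2) (hf.infOn_mono h2 h1 le_rfl)) ?_
  refine le_infOn (h1.trans h2) fun u hu hu' => ?_
  rcases le_total u m with h | h
  · exact (min_le_left _ _).trans (hf.infOn_le hu h)
  · exact (min_le_right _ _).trans (hf.infOn_le h hu')

theorem anc_refl (hf : IsExcursion f) (t : unitInterval) : Anc f t t := ⟨le_rfl, by
  rw [hf.infOn_self]; exact hf.leftVal_le t⟩

theorem anc_zero (hf : IsExcursion f) (t : unitInterval) : Anc f 0 t := by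
  refine ⟨unitInterval.nonneg', ?_⟩
  have : leftVal f 0 = 0 := by simp [leftVal]
  rw [this]
  exact le_infOn unitInterval.nonneg' fun u _ _ => hf.nonneg u

theorem meet_le_left (s t : unitInterval) : meet f s t ≤ s := sSup_le fun _ h => h.1.1

theorem meet_le_right (s t : unitInterval) : meet f s t ≤ t := sSup_le fun _ h => h.2.1

theorem le_meet {s t r : unitInterval} (h1 : Anc f r s) (h2 : Anc f r t) : r ≤ meet f s t :=
  le_sSup ⟨h1, h2⟩

theorem leftVal_meet_le (hf : IsExcursion f) {s t u : unitInterval} (hu : meet f s t ≤ u)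
    (h : ∀ r, Anc f r s → Anc f r t → Anc f r u) :
    leftVal f (meet f s t) ≤ infOn f (meet f s t) u := by
  set m := meet f s t with hm
  by_contra! hlt
  have hmpos : 0 < m := by
    rcases eq_or_lt_of_le (unitInterval.nonneg' (t := m)) with h0 | h0
    · rw [← h0] at hlt
      exact absurd (hf.anc_zero u).2 (not_le.2 hlt)
    · exact h0
  obtain ⟨C, hC1, hC2⟩ := exists_between hlt
  obtain ⟨-, ht⟩ := hf.tendsto_leftVal hmpos
  have hev : ∀ᶠ v in 𝓝[<] m, C < f v := ht.eventually (lt_mem_nhds hC2)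
  obtain ⟨a, ha, haC⟩ := (mem_nhdsLT_iff_exists_Ioo_subset' hmpos).1 hev
  obtain ⟨r, ⟨hrs, hrt⟩, har⟩ := lt_sSup_iff.1 (show a < sSup _ from ha)
  have hru := h r hrs hrt
  have hrm : r ≤ m := le_meet hrs hrt
  have h1 : C ≤ leftVal f r :=
    hf.le_leftVal har fun v hv hv' => (haC ⟨hv, hv'.trans_le hrm⟩ : C < f v).le
  have h2 : leftVal f r ≤ infOn f m u := hru.2.trans (hf.infOn_mono hu hrm le_rfl)
  linarith

theorem meet_anc_left (hf : IsExcursion f) (s t : unitInterval) : Anc f (meet f s t) s :=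
  ⟨meet_le_left s t, hf.leftVal_meet_le (meet_le_left s t) fun _ h _ => h⟩

theorem meet_anc_right (hf : IsExcursion f) (s t : unitInterval) : Anc f (meet f s t) t :=
  ⟨meet_le_right s t, hf.leftVal_meet_le (meet_le_right s t) fun _ _ h => h⟩

theorem relPos_nonneg (r t : unitInterval) : 0 ≤ relPos f r t := by
  unfold relPos; split_ifs
  · exact le_max_right _ _
  · exact le_rfl

theorem relPos_le (hf : IsExcursion f) (r t : unitInterval) : relPos f r t ≤ jump f r := by
  unfold relPos; split_ifs with h
  · have := hf.infOn_le le_rfl h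
    exact max_le (by unfold jump; linarith) (hf.jump_nonneg r)
  · exact hf.jump_nonneg r

theorem relPos_eq_zero {r t : unitInterval} (h : ¬ Anc f r t) : relPos f r t = 0 := by
  unfold relPos; split_ifs with h1
  · have : ¬ leftVal f r ≤ infOn f r t := fun h2 => h ⟨h1, h2⟩
    exact max_eq_right (by linarith)
  · rfl

theorem relPos_self (hf : IsExcursion f) (t : unitInterval) : relPos f t t = jump f t := by
  have := hf.jump_nonneg t
  simp only [relPos, le_refl, if_true, hf.infOn_self]
  exact max_eq_left this

theorem relPos_eq_of_lt (hf : IsExcursion f) {r m t : unitInterval} (hr : r < m) (hm : Anc f m t) :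
    relPos f r t = relPos f r m := by
  have : infOn f r t = infOn f r m := by
    rw [hf.infOn_split hr.le hm.1]
    exact min_eq_left ((hf.infOn_le_leftVal hr).trans hm.2)
  simp only [relPos, hr.le, hr.le.trans hm.1, if_true, this]

theorem circleDist_comm (r : unitInterval) (a b : ℝ) :
    circleDist f r a b = circleDist f r b a := by
  simp only [circleDist, abs_sub_comm a b]

theorem circleDist_self (hf : IsExcursion f) (r : unitInterval) (a : ℝ) : circleDist f r a a = 0 := by
  simpa [circleDist] using hf.jump_nonneg r

theorem circleDist_le (r : unitInterval) (a b : ℝ) : circleDist f r a b ≤ |a - b| :=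
  min_le_left _ _

theorem circleDist_nonneg {r : unitInterval} {a b : ℝ} (ha : 0 ≤ a) (ha' : a ≤ jump f r)
    (hb : 0 ≤ b) (hb' : b ≤ jump f r) : 0 ≤ circleDist f r a b := by
  refine le_min (abs_nonneg _) ?_
  have : |a - b| ≤ jump f r := abs_le.2 ⟨by linarith, by linarith⟩
  linarith

theorem circleDist_triangle {r : unitInterval} {a b c : ℝ} (ha : 0 ≤ a) (ha' : a ≤ jump f r)
    (hb : 0 ≤ b) (hb' : b ≤ jump f r) (hc : 0 ≤ c) (hc' : c ≤ jump f r) :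
    circleDist f r a c ≤ circleDist f r a b + circleDist f r b c := by
  unfold circleDist
  rcases abs_cases (a - c) with ⟨h1, h1'⟩ | ⟨h1, h1'⟩ <;>
  rcases abs_cases (a - b) with ⟨h2, h2'⟩ | ⟨h2, h2'⟩ <;>
  rcases abs_cases (b - c) with ⟨h3, h3'⟩ | ⟨h3, h3'⟩ <;>
  rw [h1, h2, h3] <;>
  rcases min_cases (a - b) (jump f r - (a - b)) with ⟨h4, _⟩ | ⟨h4, _⟩ <;>
  rcases min_cases (b - c) (jump f r - (b - c)) with ⟨h5, _⟩ | ⟨h5, _⟩ <;>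
  rcases min_cases (-(a - b)) (jump f r - -(a - b)) with ⟨h6, _⟩ | ⟨h6, _⟩ <;>
  rcases min_cases (-(b - c)) (jump f r - -(b - c)) with ⟨h7, _⟩ | ⟨h7, _⟩ <;>
  simp only [h4, h5, h6, h7] <;>
  first
    | exact (min_le_left _ _).trans (by linarith)
    | exact (min_le_right _ _).trans (by linarith)

/-- Telescoping bound for the growth above level `c`. -/
theorem sum_aux (hf : IsExcursion f) (t : unitInterval) (c : ℝ) (F : Finset unitInterval) :
    ∀ b ≤ t, (∀ r ∈ F, r < b) →
      ∑ r ∈ F, max (infOn f r t - max (leftVal f r) c) 0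
        ≤ max (min (leftVal f b) (infOn f b t)) c - c := by
  classical
  refine Finset.induction_on_max F ?_ ?_
  · intro b _ _; simp
  · intro a s ha ih b hb hF
    have hab : a < b := hF a (Finset.mem_insert_self _ _)
    have h1 := ih a (hab.le.trans hb) ha
    rw [Finset.sum_insert (fun h => lt_irrefl _ (ha a h))]
    have h2 : infOn f a t ≤ min (leftVal f b) (infOn f b t) :=
      le_min ((hf.infOn_mono hab.le le_rfl hb).trans (hf.infOn_le_leftVal hab))
        (hf.infOn_mono hb hab.le le_rfl)
    have h3 : max (infOn f a t - max (leftVal f a) c) 0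
        + max (min (leftVal f a) (infOn f a t)) c ≤ max (infOn f a t) c := by
      grind
    have h4 := max_le_max_right c h2
    linarith

theorem sum_aux' (hf : IsExcursion f) (t : unitInterval) (c : ℝ) (F : Finset unitInterval) (hF : ∀ r ∈ F, r ≤ t) :
    ∑ r ∈ F, max (infOn f r t - max (leftVal f r) c) 0 ≤ max (f t) c - c := by
  classical
  have h0 : ∀ r ∈ F.erase t, r < t := fun r hr =>
    lt_of_le_of_ne (hF r (Finset.mem_of_mem_erase hr)) (Finset.ne_of_mem_erase hr)
  have h1 := hf.sum_aux t c (F.erase t) t le_rfl h0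
  rw [hf.infOn_self, min_eq_left (hf.leftVal_le t)] at h1
  have h2 : ∑ r ∈ F, max (infOn f r t - max (leftVal f r) c) 0 ≤
      max (f t - max (leftVal f t) c) 0
        + ∑ r ∈ F.erase t, max (infOn f r t - max (leftVal f r) c) 0 := by
    by_cases ht : t ∈ F
    · rw [← Finset.add_sum_erase F _ ht, hf.infOn_self]
    · rw [Finset.erase_eq_of_notMem ht]
      linarith [le_max_right (f t - max (leftVal f t) c) 0]
  have h3 := max_le_max_right c (hf.leftVal_le t)
  have h4 : max (f t - max (leftVal f t) c) 0 ≤ max (f t) c - max (leftVal f t) c :=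
    max_le (by linarith [le_max_left (f t) c]) (by linarith)
  linarith

theorem sum_relPos_le (hf : IsExcursion f) (t : unitInterval) (F : Finset unitInterval) :
    ∑ r ∈ F, relPos f r t ≤ f t := by
  classical
  have h := hf.sum_aux' t 0 (F.filter (· ≤ t)) (fun r hr => (Finset.mem_filter.1 hr).2)
  rw [max_eq_left (hf.nonneg t), sub_zero, Finset.sum_filter] at h
  refine le_trans (Finset.sum_le_sum fun r _ => ?_) h
  simp only [relPos, max_eq_left (hf.leftVal_nonneg r)]
  exact le_rfl

theorem summable_relPos (hf : IsExcursion f) (t : unitInterval) : Summable fun r => relPos f r t :=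
  summable_of_sum_le (fun r => relPos_nonneg r t) (hf.sum_relPos_le t)

theorem circle_nonneg (hf : IsExcursion f) (r s t : unitInterval) :
    0 ≤ circleDist f r (relPos f r s) (relPos f r t) :=
  circleDist_nonneg (relPos_nonneg _ _) (hf.relPos_le _ _) (relPos_nonneg _ _) (hf.relPos_le _ _)

theorem summable_circle (hf : IsExcursion f) (s t : unitInterval) :
    Summable fun r => circleDist f r (relPos f r s) (relPos f r t) := by
  refine Summable.of_nonneg_of_le (fun r => hf.circle_nonneg r s t) (fun r => ?_)
    ((hf.summable_relPos s).add (hf.summable_relPos t))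
  refine (circleDist_le _ _ _).trans (abs_le.2 ⟨?_, ?_⟩) <;>
  linarith [relPos_nonneg (f := f) r s, relPos_nonneg (f := f) r t]

theorem circle_zero_nonneg (hf : IsExcursion f) (r t : unitInterval) : 0 ≤ circleDist f r 0 (relPos f r t) :=
  circleDist_nonneg le_rfl (hf.jump_nonneg r) (relPos_nonneg _ _) (hf.relPos_le _ _)

theorem summable_circle_zero (hf : IsExcursion f) (t : unitInterval) :
    Summable fun r => circleDist f r 0 (relPos f r t) := by
  refine Summable.of_nonneg_of_le (fun r => hf.circle_zero_nonneg r t) (fun r => ?_)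
    (hf.summable_relPos t)
  refine (circleDist_le _ _ _).trans ?_
  rw [zero_sub, abs_neg, abs_of_nonneg (relPos_nonneg _ _)]

theorem loopDist_eq (hf : IsExcursion f) (s t : unitInterval) :
    loopDist f s t = ∑' r, circleDist f r (relPos f r s) (relPos f r t) := by
  classical
  set m := meet f s t with hm
  have hs := hf.meet_anc_left s t
  have ht := hf.meet_anc_right s t
  rw [← hm] at hs ht
  let A : unitInterval → Set unitInterval := fun u => {r | (Anc f m r ∧ m ≠ r) ∧ Anc f r u}
  have hline : ∀ u, lineDist f m u
      = ∑' r, (A u).indicator (fun r => circleDist f r 0 (relPos f r u)) r := fun u =>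
    tsum_subtype (A u) (fun r => circleDist f r 0 (relPos f r u))
  have key : ∀ r, circleDist f r (relPos f r s) (relPos f r t)
      = (if r = m then circleDist f m (relPos f m s) (relPos f m t) else 0)
        + (A s).indicator (fun r => circleDist f r 0 (relPos f r s)) r
        + (A t).indicator (fun r => circleDist f r 0 (relPos f r t)) r := by
    intro r
    rcases lt_trichotomy r m with h | h | h
    · have h1 : ∀ u, r ∉ A u := fun u hu => absurd hu.1.1.1 (not_le.2 h)
      rw [hf.relPos_eq_of_lt h hs, hf.relPos_eq_of_lt h ht, hf.circleDist_self,
        if_neg h.ne, Set.indicator_of_notMem (h1 s), Set.indicator_of_notMem (h1 t)]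
      simp
    · have h1 : ∀ u, r ∉ A u := fun u hu => hu.1.2 h.symm
      rw [Set.indicator_of_notMem (h1 s), Set.indicator_of_notMem (h1 t), h, if_pos rfl]
      simp
    · have hmr : ∀ u, Anc f m u → Anc f r u → r ∈ A u := fun u hu hu' =>
        ⟨⟨⟨h.le, hu.2.trans (hf.infOn_mono h.le le_rfl hu'.1)⟩, h.ne⟩, hu'⟩
      have hnot : ∀ u, ¬ Anc f r u → r ∉ A u := fun u hu hu' => hu hu'.2
      rw [if_neg h.ne']
      by_cases h1 : Anc f r s
      · have h2 : ¬ Anc f r t := fun h2 => absurd (le_meet h1 h2) (not_le.2 h)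
        rw [Set.indicator_of_mem (hmr s hs h1), Set.indicator_of_notMem (hnot t h2),
          relPos_eq_zero h2, circleDist_comm]
        simp
      · rw [Set.indicator_of_notMem (hnot s h1), relPos_eq_zero h1]
        by_cases h2 : Anc f r t
        · rw [Set.indicator_of_mem (hmr t ht h2)]
          simp
        · rw [Set.indicator_of_notMem (hnot t h2), relPos_eq_zero h2, hf.circleDist_self]
          simp
  have e1 : Summable fun r =>
      (if r = m then circleDist f m (relPos f m s) (relPos f m t) else 0) :=
    (hasSum_ite_eq m _).summable
  have e2 := fun u => (hf.summable_circle_zero u).indicator (A u)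
  rw [tsum_congr key, (e1.add (e2 s)).tsum_add (e2 t), e1.tsum_add (e2 s), tsum_ite_eq,
    ← hline, ← hline]
  rfl

theorem loopDist_self (hf : IsExcursion f) (t : unitInterval) : loopDist f t t = 0 := by
  rw [hf.loopDist_eq]
  simp [hf.circleDist_self]

theorem loopDist_comm (hf : IsExcursion f) (s t : unitInterval) : loopDist f s t = loopDist f t s := by
  rw [hf.loopDist_eq, hf.loopDist_eq]
  exact tsum_congr fun r => circleDist_comm _ _ _

theorem loopDist_triangle (hf : IsExcursion f) (s t u : unitInterval) :
    loopDist f s u ≤ loopDist f s t + loopDist f t u := by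
  rw [hf.loopDist_eq, hf.loopDist_eq, hf.loopDist_eq,
    ← (hf.summable_circle s t).tsum_add (hf.summable_circle t u)]
  refine Summable.tsum_le_tsum (fun r => ?_) (hf.summable_circle s u)
    ((hf.summable_circle s t).add (hf.summable_circle t u))
  exact circleDist_triangle (relPos_nonneg _ _) (hf.relPos_le _ _) (relPos_nonneg _ _)
    (hf.relPos_le _ _) (relPos_nonneg _ _) (hf.relPos_le _ _)

theorem loopDist_le (hf : IsExcursion f) {s t : unitInterval} (h : s < t) :
    loopDist f s t ≤ f s + leftVal f t - 2 * infOn f s t := by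
  classical
  set c := infOn f s t with hc
  have hcs : c ≤ f s := hf.infOn_le le_rfl h.le
  have hct : c ≤ f t := hf.infOn_le h.le le_rfl
  have hcg : c ≤ leftVal f t := hf.infOn_le_leftVal h
  rw [hf.loopDist_eq]
  refine (hf.summable_circle s t).tsum_le_of_sum_le fun F => ?_
  have h1 := hf.sum_aux' s c (F.filter (· ≤ s)) (fun r hr => (Finset.mem_filter.1 hr).2)
  have h2 := hf.sum_aux t c (F.filter (fun r => s < r ∧ r < t)) t le_rfl
    (fun r hr => (Finset.mem_filter.1 hr).2.2)
  rw [hf.infOn_self, min_eq_left (hf.leftVal_le t), max_eq_left hcg, Finset.sum_filter] at h2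
  rw [max_eq_left hcs, Finset.sum_filter] at h1
  suffices hs : ∑ r ∈ F, circleDist f r (relPos f r s) (relPos f r t) ≤
      ∑ r ∈ F, ((if r ≤ s then max (infOn f r s - max (leftVal f r) c) 0 else 0)
        + (if s < r ∧ r < t then max (infOn f r t - max (leftVal f r) c) 0 else 0)) by
    rw [Finset.sum_add_distrib] at hs
    linarith
  refine Finset.sum_le_sum fun r _ => ?_
  rcases le_or_gt r s with hr | hr
  · rw [if_pos hr, if_neg (fun h' => absurd hr (not_le.2 h'.1)), add_zero]
    refine (circleDist_le _ _ _).trans ?_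
    simp only [relPos, hr, hr.trans h.le, if_true, hf.infOn_split hr h.le, ← hc]
    generalize infOn f r s = M
    generalize leftVal f r = g
    refine abs_le.2 ⟨?_, ?_⟩
    · have : max (min M c - g) 0 ≤ max (M - g) 0 :=
        max_le_max_right 0 (by linarith [min_le_left M c])
      linarith [le_max_right (M - max g c) 0]
    · rw [sub_le_iff_le_add]
      rcases max_cases g c with ⟨e1, _⟩ | ⟨e1, _⟩ <;>
      rcases min_cases M c with ⟨e2, _⟩ | ⟨e2, _⟩ <;> rw [e1, e2] <;> apply max_le <;>
      linarith [le_max_left (M - g) 0, le_max_right (M - g) 0, le_max_left (M - c) 0,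
        le_max_right (M - c) 0, le_max_left (c - g) 0, le_max_right (c - g) 0]
  · have h0 : relPos f r s = 0 := by simp [relPos, not_le.2 hr]
    rw [if_neg (not_le.2 hr), zero_add, h0]
    rcases lt_trichotomy r t with h3 | h3 | h3
    · rw [if_pos ⟨hr, h3⟩]
      refine (circleDist_le _ _ _).trans ?_
      rw [zero_sub, abs_neg, abs_of_nonneg (relPos_nonneg _ _)]
      have : c ≤ leftVal f r := (hf.infOn_mono hr.le le_rfl h3.le).trans (hf.infOn_le_leftVal hr)
      rw [max_eq_left this]
      simp [relPos, h3.le]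
    · subst h3
      rw [if_neg (fun h' => lt_irrefl _ h'.2), hf.relPos_self]
      refine (min_le_right _ _).trans ?_
      rw [zero_sub, abs_neg, abs_of_nonneg (hf.jump_nonneg r), sub_self]
    · rw [if_neg (fun h' => absurd h3 (not_lt.2 h'.2.le))]
      have : relPos f r t = 0 := by simp [relPos, not_le.2 h3]
      rw [this, hf.circleDist_self]

theorem loopDist_tendsto (hf : IsExcursion f) (t : unitInterval) :
    Tendsto (fun s => loopDist f s t) (𝓝 t) (𝓝 0) := by
  have hnn : ∀ s, 0 ≤ loopDist f s t := fun s => by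
    rw [hf.loopDist_eq]; exact tsum_nonneg fun r => hf.circle_nonneg r s t
  rw [Metric.tendsto_nhds]
  intro ε hε
  simp only [Real.dist_0_eq_abs, abs_of_nonneg (hnn _)]
  have hR : ∀ᶠ s in 𝓝[≥] t, loopDist f s t < ε := by
    have h1 : ∀ᶠ s in 𝓝[≥] t, |f s - f t| < ε / 4 := by
      have := (Metric.tendsto_nhds.1 (hf.rightCts t)) (ε / 4) (by positivity)
      simpa only [Real.dist_eq] using this
    rcases eq_or_lt_of_le (unitInterval.le_one' (t := t)) with ht | ht
    · filter_upwards [self_mem_nhdsWithin] with s hs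
      have : s = t := le_antisymm (ht ▸ unitInterval.le_one') hs
      rw [this, hf.loopDist_self]; exact hε
    · obtain ⟨b, hb, hbs⟩ := (mem_nhdsGE_iff_exists_Ico_subset' ht).1 h1
      filter_upwards [Ico_mem_nhdsGE hb] with s hs
      rcases eq_or_lt_of_le hs.1 with h | h
      · rw [← h, hf.loopDist_self]; exact hε
      · rw [hf.loopDist_comm]
        have h2 := hf.loopDist_le h
        have h3 : leftVal f s ≤ f s := hf.leftVal_le s
        have h4 : f t - ε / 4 ≤ infOn f t s := le_infOn h.le fun u hu hu' => by
          have := abs_lt.1 (show |f u - f t| < ε / 4 from hbs ⟨hu, hu'.trans_lt hs.2⟩)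
          linarith
        have h5 := abs_lt.1 (show |f s - f t| < ε / 4 from hbs ⟨hs.1, hs.2⟩)
        linarith
  have hL : ∀ᶠ s in 𝓝[<] t, loopDist f s t < ε := by
    rcases eq_or_lt_of_le (unitInterval.nonneg' (t := t)) with ht | ht
    · filter_upwards [self_mem_nhdsWithin] with s hs
      exact absurd (lt_of_lt_of_le hs ht.ge) (not_lt.2 unitInterval.nonneg')
    · have h1 : ∀ᶠ s in 𝓝[<] t, |f s - leftVal f t| < ε / 4 := by
        have := (Metric.tendsto_nhds.1 (hf.tendsto_leftVal ht).2) (ε / 4) (by positivity)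
        simpa only [Real.dist_eq] using this
      obtain ⟨b, hb, hbs⟩ := (mem_nhdsLT_iff_exists_Ioo_subset' ht).1 h1
      filter_upwards [Ioo_mem_nhdsLT hb] with s hs
      have h2 := hf.loopDist_le hs.2
      have h4 : leftVal f t - ε / 4 ≤ infOn f s t := le_infOn hs.2.le fun u hu hu' => by
        rcases eq_or_lt_of_le hu' with h | h
        · rw [h]; linarith [hf.leftVal_le t]
        · have := abs_lt.1 (show |f u - leftVal f t| < ε / 4 from hbs ⟨hs.1.trans_le hu, h⟩)
          linarith
      have h5 := abs_lt.1 (show |f s - leftVal f t| < ε / 4 from hbs hs)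
      linarith
  rw [← nhdsLT_sup_nhdsGE, eventually_sup]
  exact ⟨hL, hR⟩

end IsExcursion

/-! ### Pointed weighted compact metric spaces -/

/-- A compact metric space with a root and a Borel probability measure. -/
structure WeightedSpace where
  carrier : Type
  [metric : MetricSpace carrier]
  [compact : CompactSpace carrier]
  [measurable : MeasurableSpace carrier]
  [borel : BorelSpace carrier]
  root : carrier
  mass : Measure carrier
  [prob : IsProbabilityMeasure mass]

attribute [instance] WeightedSpace.metric WeightedSpace.compact WeightedSpace.measurable
  WeightedSpace.borel WeightedSpace.prob

/-- A metric space with all distances multiplied by `c > 0` (same uniform structure). -/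
@[reducible]
def scaleMetric {X : Type} (m : MetricSpace X) (c : ℝ) (hc : 0 < c) : MetricSpace X where
  dist x y := c * dist x y
  dist_self x := by simp
  dist_comm x y := by simp [dist_comm]
  dist_triangle x y z := by
    rw [← mul_add]; exact mul_le_mul_of_nonneg_left (dist_triangle x y z) hc.le
  eq_of_dist_eq_zero := fun {x y} h =>
    eq_of_dist_eq_zero ((mul_eq_zero.1 h).resolve_left hc.ne')
  toUniformSpace := m.toUniformSpace
  uniformity_dist := by
    rw [m.uniformity_dist]
    refine le_antisymm ?_ ?_
    · refine le_iInf₂ fun ε hε => (iInf₂_le (ε / c) (div_pos hε hc)).trans ?_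
      refine principal_mono.2 fun p hp => ?_
      have hp' : dist p.1 p.2 < ε / c := hp
      show c * dist p.1 p.2 < ε
      rwa [lt_div_iff₀ hc, mul_comm] at hp'
    · refine le_iInf₂ fun ε hε => (iInf₂_le (c * ε) (mul_pos hc hε)).trans ?_
      refine principal_mono.2 fun p hp => ?_
      have hp' : c * dist p.1 p.2 < c * ε := hp
      exact lt_of_mul_lt_mul_left hp' hc.le

/-- The space `c · X`. -/
def WeightedSpace.scale (X : WeightedSpace) (c : ℝ) (hc : 0 < c) : WeightedSpace where
  carrier := X.carrier
  metric := scaleMetric X.metric c hc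
  compact := X.compact
  measurable := X.measurable
  borel := X.borel
  root := X.root
  mass := X.mass
  prob := X.prob

/-- Correspondences between `X` and `Y`. -/
def IsCorrespondence {X Y : Type} (R : Set (X × Y)) : Prop :=
  (∀ x, ∃ y, (x, y) ∈ R) ∧ ∀ y, ∃ x, (x, y) ∈ R

/-- The distortion of a subset of `X × Y`. -/
def distortion {X Y : Type} [MetricSpace X] [MetricSpace Y] (R : Set (X × Y)) : ℝ≥0∞ :=
  ⨆ p ∈ R, ⨆ q ∈ R, ENNReal.ofReal |dist p.1 q.1 - dist p.2 q.2|

/-- The pointed Gromov-Hausdorff-Prokhorov distance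
`inf_{R,ν} max(dis(R)/2, 1-ν(R))` over compact correspondences `R` containing the pair of roots
and couplings `ν` of the two measures. -/
def ghpDist (X Y : WeightedSpace) : ℝ≥0∞ :=
  ⨅ (R : Set (X.carrier × Y.carrier)) (ν : Measure (X.carrier × Y.carrier))
    (_ : IsCorrespondence R ∧ IsCompact R ∧ (X.root, Y.root) ∈ R)
    (_ : ν.map Prod.fst = X.mass ∧ ν.map Prod.snd = Y.mass),
    max (distortion R / 2) (1 - ν R)

/-- Convergence for the pointed Gromov-Hausdorff-Prokhorov topology. -/
def GHPTendsto (X : ℕ → WeightedSpace) (Y : WeightedSpace) : Prop :=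
  Tendsto (fun n => ghpDist (X n) Y) atTop (𝓝 0)

/-! ### Quotient of `[0,1]` by a continuous pseudo-distance; the looptree of an excursion -/

/-- Continuous pseudo-distances on `[0,1]`. -/
structure IsPseudoDist (d : unitInterval → unitInterval → ℝ) : Prop where
  self : ∀ t, d t t = 0
  comm : ∀ s t, d s t = d t s
  triangle : ∀ s t u, d s u ≤ d s t + d t u
  cts : ∀ t, Tendsto (fun s => d s t) (𝓝 t) (𝓝 0)

/-- `[0,1]` endowed with the pseudo-distance `d` (rather than with the usual distance). -/
@[nolint unusedArguments]
def PreQuotient {d : unitInterval → unitInterval → ℝ} (_hd : IsPseudoDist d) : Type := unitInterval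

instance {d : unitInterval → unitInterval → ℝ} (hd : IsPseudoDist d) :
    PseudoMetricSpace (PreQuotient hd) where
  dist s t := d s t
  dist_self := hd.self
  dist_comm := hd.comm
  dist_triangle := hd.triangle

/-- The identity map from `[0,1]` to `[0,1]` endowed with `d`. -/
def toPreQuotient {d : unitInterval → unitInterval → ℝ} (hd : IsPseudoDist d) (t : unitInterval) :
    PreQuotient hd := t

/-- The canonical projection `[0,1] → [0,1]/{d = 0}`. -/
def quotientProj {d : unitInterval → unitInterval → ℝ} (hd : IsPseudoDist d) (t : unitInterval) :
    SeparationQuotient (PreQuotient hd) :=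
  SeparationQuotient.mk (toPreQuotient hd t)

theorem quotientProj_continuous {d : unitInterval → unitInterval → ℝ} (hd : IsPseudoDist d) :
    Continuous (quotientProj hd) := by
  have h : Continuous (toPreQuotient hd) := by
    refine continuous_iff_continuousAt.2 fun t => ?_
    rw [ContinuousAt, tendsto_iff_dist_tendsto_zero]
    exact hd.cts t
  exact (SeparationQuotient.continuous_mk (X := PreQuotient hd)).comp h

theorem quotientProj_surjective {d : unitInterval → unitInterval → ℝ} (hd : IsPseudoDist d) :
    Function.Surjective (quotientProj hd) :=
  SeparationQuotient.surjective_mk (X := PreQuotient hd)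

/-- The quotient metric space `[0,1]/{d = 0}`, rooted at the class of `1` and endowed with the
image of the Lebesgue measure. -/
def quotientSpace {d : unitInterval → unitInterval → ℝ} (hd : IsPseudoDist d) : WeightedSpace :=
  letI : MeasurableSpace (SeparationQuotient (PreQuotient hd)) := borel _
  haveI : BorelSpace (SeparationQuotient (PreQuotient hd)) := ⟨rfl⟩
  { carrier := SeparationQuotient (PreQuotient hd)
    compact := (quotientProj_surjective hd).compactSpace (quotientProj_continuous hd)
    root := quotientProj hd 1
    mass := (volume : Measure unitInterval).map (quotientProj hd)
    prob := Measure.isProbabilityMeasure_map (quotientProj_continuous hd).measurable.aemeasurable }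

theorem IsExcursion.isPseudoDist {f : unitInterval → ℝ} (hf : IsExcursion f) :
    IsPseudoDist (loopDist f) :=
  ⟨hf.loopDist_self, hf.loopDist_comm, hf.loopDist_triangle, hf.loopDist_tendsto⟩

/-- The looptree coded by the excursion `f`. -/
def looptree (f : unitInterval → ℝ) (hf : IsExcursion f) : WeightedSpace :=
  quotientSpace hf.isPseudoDist

/-! ### Skorokhod convergence -/

/-- The Skorokhod distance. -/
def skorokhodDist (f g : unitInterval → ℝ) : ℝ≥0∞ :=
  ⨅ e : unitInterval ≃o unitInterval,
    max (⨆ t, ENNReal.ofReal |(e t : ℝ) - t|) (⨆ t, ENNReal.ofReal |f t - g (e t)|)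

/-- `Θf(t) = 1_{2t ≥ 1} f(2t-1)`. -/
def theta (f : unitInterval → ℝ) (t : unitInterval) : ℝ :=
  if h : 1 ≤ 2 * (t : ℝ) then f ⟨2 * (t : ℝ) - 1, by linarith, by linarith [t.2.2]⟩ else 0

/-- Convergence for the relaxed Skorokhod topology. -/
def RelaxedSkorokhodTendsto (F : ℕ → unitInterval → ℝ) (f : unitInterval → ℝ) : Prop :=
  Tendsto (fun n => skorokhodDist (theta (F n)) (theta f)) atTop (𝓝 0)

/-! ### Plane trees, Łukasiewicz walks and discrete looptrees -/

/-- A plane tree: a finite set of words, containing the empty word, stable under taking parents,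
and in which the children of a vertex `u` are exactly `u * (1), …, u * (k)` for some `k ≥ 0`.
(All letters of a word of the tree are thus positive.) -/
structure PlaneTree where
  verts : Finset (List ℕ)
  nil_mem : [] ∈ verts
  parent_mem : ∀ u j, u ++ [j] ∈ verts → u ∈ verts
  children : ∀ u ∈ verts, ∃ k : ℕ, ∀ j, u ++ [j] ∈ verts ↔ 1 ≤ j ∧ j ≤ k

namespace PlaneTree

variable (τ : PlaneTree)

/-- The number of vertices. -/
def size : ℕ := τ.verts.card

/-- The maximal generation of a vertex. -/
def height : ℕ := τ.verts.sup List.length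

/-- The number of children of `u`. -/
def numChildren (u : List ℕ) : ℕ := Set.ncard {j : ℕ | u ++ [j] ∈ τ.verts}

theorem child_mem_iff {u : List ℕ} (hu : u ∈ τ.verts) (j : ℕ) :
    u ++ [j] ∈ τ.verts ↔ 1 ≤ j ∧ j ≤ τ.numChildren u := by
  obtain ⟨k, hk⟩ := τ.children u hu
  have h : {j : ℕ | u ++ [j] ∈ τ.verts} = Finset.Icc 1 k := by
    ext j; simp [hk]
  rw [numChildren, h, Set.ncard_coe_finset, Nat.card_Icc, hk]
  simp

/-- The depth-first exploration: `τ.dfs i` is the `i`-th vertex in the lexicographic order. -/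
def dfs (i : Fin τ.size) : List ℕ := τ.verts.orderEmbOfFin rfl i

/-- The Łukasiewicz walk `L_i = ∑_{j < i} (k_{u(j)} - 1)`, for `0 ≤ i ≤ #τ`. -/
def lukasiewicz (i : ℕ) : ℤ :=
  ∑ j : Fin τ.size, if (j : ℕ) < i then (τ.numChildren (τ.dfs j) : ℤ) - 1 else 0

/-- The rescaled walk `t ↦ a⁻¹ L_{⌊t #τ⌋}` on `[0,1]`. -/
def rescaledWalk (a : ℝ) (t : unitInterval) : ℝ :=
  a⁻¹ * (τ.lukasiewicz ⌊(t : ℝ) * τ.size⌋₊ : ℝ)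

/-- The conditions under which an edge of the discrete looptree joins `u` to `v`: consecutive
siblings, first child, last child, and the self-loop at a leaf. -/
def LoopEdge (u v : List ℕ) : Prop :=
  (∃ w j, 1 ≤ j ∧ u = w ++ [j] ∧ v = w ++ [j + 1]) ∨ v = u ++ [1]
    ∨ v = u ++ [τ.numChildren u] ∨ (u = v ∧ τ.numChildren u = 0)

/-- The type of vertices of `τ`. -/
def Vertex : Type := {u : List ℕ // u ∈ τ.verts}

instance : Fintype τ.Vertex := inferInstanceAs (Fintype {u : List ℕ // u ∈ τ.verts})

instance : Nonempty τ.Vertex := ⟨⟨[], τ.nil_mem⟩⟩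

/-- The discrete looptree as a graph on the vertices of `τ`. Loops and multiplicities of edges are
dropped, as they do not affect the graph distance. -/
def loopGraph : SimpleGraph τ.Vertex :=
  SimpleGraph.fromRel fun u v => τ.LoopEdge u.1 v.1

theorem reachable_root (u : List ℕ) :
    ∀ hu : u ∈ τ.verts, τ.loopGraph.Reachable ⟨[], τ.nil_mem⟩ ⟨u, hu⟩ := by
  induction u using List.reverseRecOn with
  | nil => intro _; exact SimpleGraph.Reachable.refl _
  | append_singleton u j ih =>
    have hadj : ∀ {a b : List ℕ} (ha : a ∈ τ.verts) (hb : b ∈ τ.verts), a ≠ b → τ.LoopEdge a b →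
        τ.loopGraph.Reachable ⟨a, ha⟩ ⟨b, hb⟩ := fun ha hb hne he =>
      SimpleGraph.Adj.reachable ((SimpleGraph.fromRel_adj _ _ _).2
        ⟨fun h => hne (Subtype.ext_iff.1 h), Or.inl he⟩)
    induction j with
    | zero =>
      intro hu
      have := ((τ.child_mem_iff (τ.parent_mem _ _ hu) 0).1 hu).1
      omega
    | succ j ihj =>
      intro hu
      have hp := τ.parent_mem _ _ hu
      have hj := (τ.child_mem_iff hp _).1 hu
      rcases Nat.eq_zero_or_pos j with h0 | h0
      · subst h0
        exact (ih hp).trans (hadj hp hu (by simp) (Or.inr (Or.inl rfl)))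
      · have hm := (τ.child_mem_iff hp j).2 ⟨h0, by omega⟩
        exact (ihj hm).trans (hadj hm hu (by simp) (Or.inl ⟨u, j, h0, rfl, rfl⟩))

theorem loopGraph_connected : τ.loopGraph.Connected where
  preconnected u v := (τ.reachable_root u.1 u.2).symm.trans (τ.reachable_root v.1 v.2)
  nonempty := ⟨⟨[], τ.nil_mem⟩⟩

/-- The graph distance of the discrete looptree. -/
@[reducible]
def loopMetric : MetricSpace τ.Vertex where
  dist u v := τ.loopGraph.dist u v
  dist_self u := by simp
  dist_comm u v := by rw [SimpleGraph.dist_comm]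
  dist_triangle u v w := by exact_mod_cast τ.loopGraph_connected.dist_triangle
  eq_of_dist_eq_zero := fun {u v} h =>
    τ.loopGraph_connected.dist_eq_zero_iff.1 (by exact_mod_cast h)

/-- The discrete looptree `Loop(τ)`: the vertices of `τ` with the graph distance, the root `∅`
and the uniform probability measure. -/
def loop : WeightedSpace :=
  letI := τ.loopMetric
  letI : MeasurableSpace τ.Vertex := borel _
  haveI : BorelSpace τ.Vertex := ⟨rfl⟩
  { carrier := τ.Vertex
    root := ⟨[], τ.nil_mem⟩
    mass := (PMF.uniformOfFintype τ.Vertex).toMeasure }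

end PlaneTree

end LoopTree

end

/-!
The discrete and the continuous looptree distances have the same shape. Let `x_r^t` be the position
of `t` on the loop of `r`. By `IsExcursion.loopDist_eq` the distance coded by `f` is the sum over
all loops `r` of the distances, measured on a circle of length `Δ_r`, between `x_r^s` and `x_r^t`.
Likewise the graph distance of `Loop(τ)` is the sum over all vertices `w` of the distances, measured
on a circle of length `k_w + 1`, between the positions of the two vertices on the cycle of `w`
(`PlaneTree.dist_eq_loopSum`): the sum is `1`-Lipschitz along edges, and a path of the right length
is found by following the cycles. Counted from the last child, the positions on the cycle of the
`w`-th vertex are the running minima of `L - L_w + 1` after step `w`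
(`PlaneTree.posAt_le_max_lukasiewicz`, `PlaneTree.exists_max_lukasiewicz_le_posAt`), exactly as
`x_r^t` is obtained from `f`, and the positions of a vertex on all cycles add up to the Łukasiewicz
walk plus the generation of the vertex (`PlaneTree.sum_posAt_le`).

For a PJG excursion, finitely many loops `F` explain `f` up to a small error, uniformly in time
(`IsExcursion.exists_finset_sub_sum_relPos_lt`). This is Dini's theorem: `f(t) - ∑_{r ∈ F} x_r^t`
decreases to `0` pointwise, and it is upper semicontinuous because the jumps of `f` are nonnegative.
Under a time change that makes the walk uniformly close to `f`, each jump of `f` at a time of `F` is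
matched with a single step of the walk (`PlaneTree.exists_matching_step`), and the positions on the
two loops are then uniformly close, since they only depend on running infima
(`PlaneTree.abs_posAt_sub_relPos_le`). What remains of either distance is bounded by the sum of the
remaining positions, that is, by the coding function minus the contribution of the matched loops.
In the limit this is the same small quantity on both sides, as the generations are negligible; the
unmatched cycles need not be controlled one by one (`PlaneTree.abs_dist_sub_loopDist_le`).

Hence the distances converge uniformly along the exploration
(`eventually_abs_dist_sub_loopDist_le`), where the time change is removed by the continuity of the
looptree distance. Both spaces being parametrized by `[0,1]` with its Lebesgue measure, uniform
convergence gives a coupling carried by a correspondence of small distortion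
(`ghpDist_le_of_parametrization`).
-/

namespace LoopTree

/-! ### The depth-first order on words -/

theorem lt_append_zero_iff (x w : List ℕ) : x < w ++ [0] ↔ x < w ∨ x = w := by
  induction w generalizing x with
  | nil =>
    cases x with
    | nil => simp
    | cons a x => simp [List.cons_lt_cons_iff]
  | cons b w ih =>
    cases x with
    | nil => simp
    | cons a x =>
      simp only [List.cons_append, List.cons_lt_cons_iff, ih, List.cons.injEq]
      tauto

theorem lt_append_succ_iff (x w : List ℕ) (j : ℕ) :
    x < w ++ [j + 1] ↔ x < w ++ [j] ∨ w ++ [j] <+: x := by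
  induction w generalizing x with
  | nil =>
    cases x with
    | nil => simp
    | cons a x =>
      simp only [List.nil_append, List.cons_lt_cons_iff, List.not_lt_nil, and_false, or_false,
        List.cons_prefix_cons, List.nil_prefix, and_true]
      omega
  | cons b w ih =>
    cases x with
    | nil => simp
    | cons a x =>
      simp only [List.cons_append, List.cons_lt_cons_iff, ih, List.cons_prefix_cons]
      tauto

theorem prefix_or_lt {w r : List ℕ} (h : w <+: r) : w < r ∨ w = r := by
  obtain ⟨s, rfl⟩ := h
  cases s with
  | nil => simp
  | cons a s =>
    left
    have := List.append_left_lt (l₁ := w) (List.nil_lt_cons a s)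
    simpa using this

/-- Two words in increasing order, the first of which is not a prefix of the second one, differ
at a first letter. -/
theorem exists_branching {w v : List ℕ} (h : w < v) (hp : ¬ w <+: v) :
    ∃ c a b w' v', a < b ∧ w = c ++ a :: w' ∧ v = c ++ b :: v' := by
  induction w generalizing v with
  | nil => exact absurd List.nil_prefix hp
  | cons a w ih =>
    cases v with
    | nil => exact absurd h (List.not_lt_nil _)
    | cons b v =>
      rcases List.cons_lt_cons_iff.1 h with hab | ⟨rfl, hwv⟩
      · exact ⟨[], a, b, w, v, hab, rfl, rfl⟩
      · obtain ⟨c, a', b', w', v', h1, h2, h3⟩ :=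
          ih hwv fun h' => hp (List.cons_prefix_cons.2 ⟨rfl, h'⟩)
        exact ⟨a :: c, a', b', w', v', h1, by rw [h2]; rfl, by rw [h3]; rfl⟩

theorem append_cons_lt {c u v : List ℕ} {a b : ℕ} (h : a < b) : c ++ a :: u < c ++ b :: v :=
  List.append_left_lt (List.cons_lt_cons_iff.2 (Or.inl h))

/-- The words with a given prefix form an interval. -/
theorem prefix_of_between {w x r : List ℕ} (h : w < x) (h' : ¬ w ++ r < x) : w <+: x := by
  by_contra hp
  obtain ⟨c, a, b, w', v', hab, rfl, rfl⟩ := exists_branching h hp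
  refine h' ?_
  rw [List.append_assoc]
  exact append_cons_lt hab

/-- The first letter of `v` after the prefix `w`, and `0` if `w` is not a strict prefix of `v`. -/
def branch (w v : List ℕ) : ℕ := if w <+: v then (v.drop w.length).headD 0 else 0

theorem branch_self (w : List ℕ) : branch w w = 0 := by simp [branch]

theorem branch_append_cons (w : List ℕ) (j : ℕ) (r : List ℕ) : branch w (w ++ j :: r) = j := by
  simp [branch]

theorem branch_of_not_prefix {w v : List ℕ} (h : ¬ w <+: v) : branch w v = 0 := if_neg h

theorem branch_append_singleton {x w : List ℕ} (h : x ≠ w) (j : ℕ) :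
    branch x (w ++ [j]) = branch x w := by
  by_cases hx : x <+: w
  · obtain ⟨s, rfl⟩ := hx
    cases s with
    | nil => simp at h
    | cons a s => rw [List.append_assoc, List.cons_append, branch_append_cons, branch_append_cons]
  · rw [branch_of_not_prefix hx]
    by_cases hx' : x <+: w ++ [j]
    · rcases List.prefix_concat_iff.1 hx' with rfl | h'
      · exact branch_self _
      · exact absurd h' hx
    · exact branch_of_not_prefix hx'

/-! ### The distance on a circle -/

/-- The distance between the points `a` and `b` of a circle of length `K`. -/
def cyc (K a b : ℝ) : ℝ := min |a - b| (K - |a - b|)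

theorem cyc_comm (K a b : ℝ) : cyc K a b = cyc K b a := by simp only [cyc, abs_sub_comm]

theorem cyc_self {K : ℝ} (hK : 0 ≤ K) (a : ℝ) : cyc K a a = 0 := by simpa [cyc] using hK

theorem cyc_le_abs (K a b : ℝ) : cyc K a b ≤ |a - b| := min_le_left _ _

theorem cyc_nonneg {K a b : ℝ} (ha : 0 ≤ a) (ha' : a ≤ K) (hb : 0 ≤ b) (hb' : b ≤ K) :
    0 ≤ cyc K a b :=
  le_min (abs_nonneg _) (sub_nonneg.2 (abs_le.2 ⟨by linarith, by linarith⟩))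

theorem cyc_le_add {K a b : ℝ} (ha : 0 ≤ a) (hb : 0 ≤ b) : cyc K a b ≤ a + b :=
  (cyc_le_abs K a b).trans (abs_le.2 ⟨by linarith, by linarith⟩)

theorem cyc_triangle {K a b c : ℝ} (ha : 0 ≤ a) (ha' : a ≤ K) (hb : 0 ≤ b) (hb' : b ≤ K)
    (hc : 0 ≤ c) (hc' : c ≤ K) : cyc K a c ≤ cyc K a b + cyc K b c := by
  unfold cyc
  rw [← min_add_add_left, ← min_add_add_right, ← min_add_add_right]
  refine le_min (le_min ?_ ?_) (le_min ?_ ?_)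
  · exact (min_le_left _ _).trans (abs_sub_le _ _ _)
  · refine (min_le_right _ _).trans ?_
    have := abs_sub_le a c b
    rw [abs_sub_comm c b] at this
    linarith
  · refine (min_le_right _ _).trans ?_
    have := abs_sub_le b a c
    rw [abs_sub_comm b a] at this
    linarith
  · refine (min_le_left _ _).trans ?_
    rcases abs_cases (a - c) with h1 | h1 <;> rcases abs_cases (a - b) with h2 | h2 <;>
      rcases abs_cases (b - c) with h3 | h3 <;> linarith

theorem cyc_sub_le (K K' a a' b b' : ℝ) :
    cyc K a b - cyc K' a' b' ≤ |K - K'| + |a - a'| + |b - b'| := by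
  have h1 : |a - b| - |a' - b'| ≤ |a - a'| + |b - b'| := by
    have := abs_sub_abs_le_abs_sub (a - b) (a' - b')
    have h2 := abs_sub (a - a') (b - b')
    rw [show a - b - (a' - b') = a - a' - (b - b') by ring] at this
    linarith
  have h1' : |a' - b'| - |a - b| ≤ |a - a'| + |b - b'| := by
    have := abs_sub_abs_le_abs_sub (a' - b') (a - b)
    have h2 := abs_sub (b - b') (a - a')
    rw [show a' - b' - (a - b) = b - b' - (a - a') by ring] at this
    linarith
  have h3 := abs_nonneg (K - K')
  have h4 := le_abs_self (K - K')
  unfold cyc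
  rw [sub_le_iff_le_add, ← min_add_add_left]
  exact le_min ((min_le_left _ _).trans (by linarith)) ((min_le_right _ _).trans (by linarith))

theorem abs_cyc_sub_cyc_le (K K' a a' b b' : ℝ) :
    |cyc K a b - cyc K' a' b'| ≤ |K - K'| + |a - a'| + |b - b'| := by
  refine abs_sub_le_iff.2 ⟨cyc_sub_le _ _ _ _ _ _, ?_⟩
  rw [abs_sub_comm K, abs_sub_comm a, abs_sub_comm b]
  exact cyc_sub_le _ _ _ _ _ _

theorem cyc_mul {c : ℝ} (hc : 0 ≤ c) (K a b : ℝ) :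
    cyc (c * K) (c * a) (c * b) = c * cyc K a b := by
  rw [cyc, cyc, ← mul_sub, abs_mul, abs_of_nonneg hc, ← mul_sub, mul_min_of_nonneg _ _ hc]

namespace PlaneTree

variable (τ : PlaneTree)

/-! ### The graph distance of a discrete looptree as a sum over cycles -/

theorem mem_of_prefix {x v : List ℕ} (h : x <+: v) (hv : v ∈ τ.verts) : x ∈ τ.verts := by
  obtain ⟨s, rfl⟩ := h
  induction s using List.reverseRecOn with
  | nil => simpa using hv
  | append_singleton s j ih => exact ih (τ.parent_mem _ j (by rwa [List.append_assoc]))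

theorem letter_bounds {w r : List ℕ} {j : ℕ} (h : w ++ j :: r ∈ τ.verts) :
    1 ≤ j ∧ j ≤ τ.numChildren w := by
  have h1 : w ++ [j] ∈ τ.verts := τ.mem_of_prefix ⟨r, by simp⟩ h
  exact (τ.child_mem_iff (τ.parent_mem _ _ h1) j).1 h1

/-- The position of `v` on the cycle of `w`, a cycle of length `k_w + 1`: it is `0` if `v` is not a
strict descendant of `w`, and otherwise the rank, counted from the last child, of the child of `w`
from which `v` descends. Counting from the last child is what the Łukasiewicz walk does. -/
noncomputable def pos (w v : List ℕ) : ℤ :=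
  if branch w v = 0 then 0 else τ.numChildren w + 1 - branch w v

theorem pos_self (w : List ℕ) : τ.pos w w = 0 := by simp [pos, branch_self]

theorem pos_append_cons (w r : List ℕ) {j : ℕ} (hj : 1 ≤ j) :
    τ.pos w (w ++ j :: r) = τ.numChildren w + 1 - j := by
  rw [pos, branch_append_cons, if_neg (by omega)]

theorem pos_of_not_prefix {w v : List ℕ} (h : ¬ w <+: v) : τ.pos w v = 0 := by
  simp [pos, branch_of_not_prefix h]

theorem pos_append_singleton {x w : List ℕ} (h : x ≠ w) (j : ℕ) :
    τ.pos x (w ++ [j]) = τ.pos x w := by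
  simp only [pos, branch_append_singleton h]

theorem pos_cases {v : List ℕ} (hv : v ∈ τ.verts) (w : List ℕ) :
    τ.pos w v = 0 ∨ ∃ j r, v = w ++ j :: r ∧ 1 ≤ j ∧ j ≤ τ.numChildren w ∧
      τ.pos w v = τ.numChildren w + 1 - j := by
  by_cases h : w <+: v
  · obtain ⟨s, rfl⟩ := h
    cases s with
    | nil => left; rw [List.append_nil, pos_self]
    | cons j r =>
      have := τ.letter_bounds hv
      exact Or.inr ⟨j, r, rfl, this.1, this.2, τ.pos_append_cons w r this.1⟩
  · exact Or.inl (τ.pos_of_not_prefix h)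

theorem pos_nonneg {v : List ℕ} (hv : v ∈ τ.verts) (w : List ℕ) : 0 ≤ τ.pos w v := by
  rcases τ.pos_cases hv w with h | ⟨j, r, -, -, h1, h⟩ <;> omega

theorem pos_le {v : List ℕ} (hv : v ∈ τ.verts) (w : List ℕ) :
    τ.pos w v ≤ τ.numChildren w + 1 := by
  rcases τ.pos_cases hv w with h | ⟨j, r, -, -, h1, h⟩ <;> omega

/-- The distance between `u` and `v` measured on the cycle of `w`. -/
noncomputable def cycleDist (w u v : List ℕ) : ℝ :=
  cyc (τ.numChildren w + 1) (τ.pos w u) (τ.pos w v)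

/-- The sum of the distances between `u` and `v` measured on all cycles. -/
noncomputable def loopSum (u v : List ℕ) : ℝ := ∑ w ∈ τ.verts, τ.cycleDist w u v

theorem cycleDist_of_eq {w u v : List ℕ} (h : τ.pos w u = τ.pos w v) : τ.cycleDist w u v = 0 := by
  rw [cycleDist, h, cyc_self (by positivity)]

theorem cycleDist_comm (w u v : List ℕ) : τ.cycleDist w u v = τ.cycleDist w v u := cyc_comm _ _ _

theorem loopSum_comm (u v : List ℕ) : τ.loopSum u v = τ.loopSum v u :=
  Finset.sum_congr rfl fun _ _ => τ.cycleDist_comm _ _ _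

theorem loopSum_triangle {u v w : List ℕ} (hu : u ∈ τ.verts) (hv : v ∈ τ.verts)
    (hw : w ∈ τ.verts) : τ.loopSum u w ≤ τ.loopSum u v + τ.loopSum v w := by
  rw [loopSum, loopSum, loopSum, ← Finset.sum_add_distrib]
  refine Finset.sum_le_sum fun x _ => cyc_triangle ?_ ?_ ?_ ?_ ?_ ?_
  · exact_mod_cast τ.pos_nonneg hu x
  · exact_mod_cast τ.pos_le hu x
  · exact_mod_cast τ.pos_nonneg hv x
  · exact_mod_cast τ.pos_le hv x
  · exact_mod_cast τ.pos_nonneg hw x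
  · exact_mod_cast τ.pos_le hw x

theorem loopSum_eq_single {w u v : List ℕ} (hw : w ∈ τ.verts)
    (h : ∀ x, x ≠ w → τ.pos x u = τ.pos x v) : τ.loopSum u v = τ.cycleDist w u v :=
  Finset.sum_eq_single_of_mem w hw fun x _ hx => τ.cycleDist_of_eq (h x hx)

/-- The endpoints of an edge are at distance at most `1`, since only one cycle separates them. -/
theorem loopSum_le_one_of_loopEdge {u v : List ℕ} (hu : u ∈ τ.verts) (hv : v ∈ τ.verts)
    (h : τ.LoopEdge u v) : τ.loopSum u v ≤ 1 := by
  rcases h with ⟨w, j, hj, rfl, rfl⟩ | rfl | rfl | ⟨rfl, -⟩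
  · rw [τ.loopSum_eq_single (τ.parent_mem _ _ hu) fun x hx => by
      rw [τ.pos_append_singleton hx, τ.pos_append_singleton hx],
      cycleDist, τ.pos_append_cons _ _ hj, τ.pos_append_cons _ _ (by omega)]
    refine (cyc_le_abs _ _ _).trans (le_of_eq ?_)
    push_cast
    ring_nf
    simp
  · rw [τ.loopSum_eq_single hu fun x hx => by rw [τ.pos_append_singleton hx],
      cycleDist, τ.pos_append_cons _ _ le_rfl, pos_self]
    refine (min_le_right _ _).trans (le_of_eq ?_)
    push_cast
    rw [abs_sub_comm, sub_zero, abs_of_nonneg (by simp)]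
    ring
  · rw [τ.loopSum_eq_single hu fun x hx => by rw [τ.pos_append_singleton hx],
      cycleDist, τ.pos_append_cons _ _ (τ.letter_bounds hv).1, pos_self]
    refine (cyc_le_abs _ _ _).trans (le_of_eq ?_)
    push_cast
    ring_nf
    simp
  · rw [loopSum, Finset.sum_eq_zero fun x _ => τ.cycleDist_of_eq rfl]
    exact zero_le_one

theorem loopSum_le_dist (u v : τ.Vertex) : τ.loopSum u.1 v.1 ≤ τ.loopGraph.dist u v := by
  obtain ⟨p, hp⟩ := τ.loopGraph_connected.exists_walk_length_eq_dist u v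
  rw [← hp]
  clear hp
  induction p with
  | nil =>
    rw [loopSum, Finset.sum_eq_zero fun x _ => τ.cycleDist_of_eq rfl]
    simp
  | @cons a b c hab p ih =>
    have h1 : τ.loopSum a.1 b.1 ≤ 1 := by
      rcases ((SimpleGraph.fromRel_adj _ _ _).1 hab).2 with h | h
      · exact τ.loopSum_le_one_of_loopEdge a.2 b.2 h
      · rw [loopSum_comm]
        exact τ.loopSum_le_one_of_loopEdge b.2 a.2 h
    have h2 := τ.loopSum_triangle a.2 b.2 c.2
    rw [SimpleGraph.Walk.length_cons]
    push_cast
    linarith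

/-- The graph distance between two words of the tree. -/
noncomputable def wordDist {u v : List ℕ} (hu : u ∈ τ.verts) (hv : v ∈ τ.verts) : ℕ :=
  τ.loopGraph.dist ⟨u, hu⟩ ⟨v, hv⟩

theorem wordDist_comm {u v : List ℕ} (hu : u ∈ τ.verts) (hv : v ∈ τ.verts) :
    τ.wordDist hu hv = τ.wordDist hv hu := SimpleGraph.dist_comm

theorem wordDist_self {u : List ℕ} (hu : u ∈ τ.verts) : τ.wordDist hu hu = 0 :=
  SimpleGraph.dist_self

theorem wordDist_triangle {u v w : List ℕ} (hu : u ∈ τ.verts) (hv : v ∈ τ.verts)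
    (hw : w ∈ τ.verts) : τ.wordDist hu hw ≤ τ.wordDist hu hv + τ.wordDist hv hw :=
  τ.loopGraph_connected.dist_triangle

theorem wordDist_le_one_of_loopEdge {u v : List ℕ} (hu : u ∈ τ.verts) (hv : v ∈ τ.verts)
    (h : τ.LoopEdge u v) : τ.wordDist hu hv ≤ 1 := by
  by_cases huv : u = v
  · subst huv
    rw [wordDist_self]
    exact zero_le_one
  · exact (SimpleGraph.dist_eq_one_iff_adj.2
      ((SimpleGraph.fromRel_adj _ _ _).2 ⟨fun h' => huv (Subtype.ext_iff.1 h'), Or.inl h⟩)).le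

/-- Walking on the cycle of `w` from its `i`-th child to its `j`-th child in increasing order. -/
theorem wordDist_siblings_le {w : List ℕ} {i : ℕ} (hi : w ++ [i] ∈ τ.verts) :
    ∀ d (hj : w ++ [i + d] ∈ τ.verts), τ.wordDist hi hj ≤ d := by
  intro d
  induction d with
  | zero => intro _; exact (τ.wordDist_self hi).le
  | succ d ih =>
    intro hj
    have hw := τ.parent_mem _ _ hi
    have h1 := (τ.child_mem_iff hw _).1 hi
    have h2 := (τ.child_mem_iff hw _).1 hj
    have hm : w ++ [i + d] ∈ τ.verts := (τ.child_mem_iff hw _).2 ⟨by omega, by omega⟩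
    have h3 := τ.wordDist_le_one_of_loopEdge hm hj (Or.inl ⟨w, i + d, by omega, rfl, rfl⟩)
    have h4 := τ.wordDist_triangle hi hm hj
    have h5 := ih hm
    omega

/-- A vertex is joined to its `j`-th child by the two arcs of its cycle. -/
theorem wordDist_child_le {w : List ℕ} {j : ℕ} (hw : w ∈ τ.verts) (hj : w ++ [j] ∈ τ.verts) :
    τ.wordDist hw hj ≤ j ∧ τ.wordDist hw hj + j ≤ τ.numChildren w + 1 := by
  have h := (τ.child_mem_iff hw _).1 hj
  have hf : w ++ [1] ∈ τ.verts := (τ.child_mem_iff hw _).2 ⟨le_rfl, by omega⟩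
  have hl : w ++ [τ.numChildren w] ∈ τ.verts := (τ.child_mem_iff hw _).2 ⟨by omega, le_rfl⟩
  have h1 := τ.wordDist_le_one_of_loopEdge hw hf (Or.inr (Or.inl rfl))
  have h2 := τ.wordDist_le_one_of_loopEdge hw hl (Or.inr (Or.inr (Or.inl rfl)))
  obtain ⟨d, rfl⟩ : ∃ d, j = 1 + d := ⟨j - 1, by omega⟩
  have h3 := τ.wordDist_siblings_le hf d hj
  obtain ⟨e, he⟩ : ∃ e, τ.numChildren w = 1 + d + e := ⟨τ.numChildren w - (1 + d), by omega⟩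
  have h4 : τ.wordDist hj hl ≤ e := by
    have := τ.wordDist_siblings_le hj e (by rwa [← he])
    simpa only [he] using this
  have h5 := τ.wordDist_triangle hw hf hj
  have h6 := τ.wordDist_triangle hw hl hj
  rw [τ.wordDist_comm hl hj] at h6
  omega

theorem wordDist_child_le_cycleDist {w : List ℕ} {j : ℕ} (hw : w ∈ τ.verts)
    (hj : w ++ [j] ∈ τ.verts) : (τ.wordDist hw hj : ℝ) ≤ τ.cycleDist w w (w ++ [j]) := by
  have h := (τ.child_mem_iff hw _).1 hj
  obtain ⟨h1, h2⟩ := τ.wordDist_child_le hw hj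
  have h1' : (τ.wordDist hw hj : ℝ) ≤ j := by exact_mod_cast h1
  have h2' : (τ.wordDist hw hj : ℝ) + j ≤ τ.numChildren w + 1 := by exact_mod_cast h2
  have h3 : (j : ℝ) ≤ τ.numChildren w := by exact_mod_cast h.2
  rw [cycleDist, τ.pos_append_cons _ _ h.1, pos_self, cyc]
  push_cast
  rw [zero_sub, abs_neg, abs_of_nonneg (by linarith)]
  exact le_min (by linarith) (by linarith)

theorem wordDist_siblings_le_cycleDist {w : List ℕ} {i j : ℕ} (hi : w ++ [i] ∈ τ.verts)
    (hj : w ++ [j] ∈ τ.verts) :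
    (τ.wordDist hi hj : ℝ) ≤ τ.cycleDist w (w ++ [i]) (w ++ [j]) := by
  wlog hij : i ≤ j generalizing i j
  · rw [wordDist_comm, cycleDist_comm]
    exact this hj hi (by omega)
  obtain ⟨d, rfl⟩ := Nat.exists_eq_add_of_le hij
  have hw := τ.parent_mem _ _ hi
  have h := (τ.child_mem_iff hw _).1 hi
  have h1 := τ.wordDist_siblings_le hi d hj
  have h2 := (τ.wordDist_child_le hw hi).1
  have h3 := (τ.wordDist_child_le hw hj).2
  have h4 := τ.wordDist_triangle hi hw hj
  rw [τ.wordDist_comm hi hw] at h4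
  have h5 : τ.wordDist hi hj + d ≤ τ.numChildren w + 1 := by omega
  have h1' : (τ.wordDist hi hj : ℝ) ≤ d := by exact_mod_cast h1
  have h5' : (τ.wordDist hi hj : ℝ) + d ≤ τ.numChildren w + 1 := by exact_mod_cast h5
  rw [cycleDist, τ.pos_append_cons _ _ h.1, τ.pos_append_cons _ _ (by omega), cyc]
  push_cast
  rw [show (τ.numChildren w + 1 - i - (τ.numChildren w + 1 - (i + d)) : ℝ) = d by ring,
    abs_of_nonneg (by positivity)]
  exact le_min h1' (by linarith)

/-- Removing the last letter of a word whose parent is not a prefix of `v`. -/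
theorem loopSum_append_singleton {w v : List ℕ} {j : ℕ} (hw : w ∈ τ.verts) (h : ¬ w <+: v) :
    τ.loopSum (w ++ [j]) v = τ.loopSum w v + τ.cycleDist w w (w ++ [j]) := by
  rw [loopSum, loopSum, ← Finset.add_sum_erase _ _ hw,
    ← Finset.add_sum_erase _ (fun x => τ.cycleDist x w v) hw,
    τ.cycleDist_of_eq ((τ.pos_self w).trans (τ.pos_of_not_prefix h).symm), zero_add, add_comm]
  congr 1
  · refine Finset.sum_congr rfl fun x hx => ?_
    rw [cycleDist, cycleDist, τ.pos_append_singleton (Finset.ne_of_mem_erase hx)]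
  · rw [cycleDist, cycleDist, pos_self, τ.pos_of_not_prefix h, cyc_comm]

theorem wordDist_parent_le_loopSum {w : List ℕ} {j : ℕ} (hw : w ∈ τ.verts)
    (hu : w ++ [j] ∈ τ.verts) : (τ.wordDist hw hu : ℝ) ≤ τ.loopSum w (w ++ [j]) := by
  rw [τ.loopSum_eq_single hw fun x hx => by rw [τ.pos_append_singleton hx]]
  exact τ.wordDist_child_le_cycleDist hw hu

/-- The upper bound is obtained by shortening one of the two words until they are equal, parent
and child, or siblings. -/
theorem wordDist_le_loopSum (n : ℕ) : ∀ {u v : List ℕ} (hu : u ∈ τ.verts) (hv : v ∈ τ.verts),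
    u.length + v.length = n → (τ.wordDist hu hv : ℝ) ≤ τ.loopSum u v := by
  induction n using Nat.strong_induction_on with
  | _ n ih =>
  have shrink : ∀ {w v : List ℕ} {j : ℕ} (hu : w ++ [j] ∈ τ.verts) (hv : v ∈ τ.verts),
      ¬ w <+: v → w.length + 1 + v.length = n →
      (τ.wordDist hu hv : ℝ) ≤ τ.loopSum (w ++ [j]) v := by
    intro w v j hu hv hp hn
    have hw := τ.parent_mem _ _ hu
    rw [τ.loopSum_append_singleton hw hp]
    have h1 := ih (w.length + v.length) (by omega) hw hv rfl
    have h2 := τ.wordDist_child_le_cycleDist hw hu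
    have h3 := τ.wordDist_triangle hu hw hv
    rw [τ.wordDist_comm hu hw] at h3
    have h3' : (τ.wordDist hu hv : ℝ) ≤ τ.wordDist hw hu + τ.wordDist hw hv := by
      exact_mod_cast h3
    linarith
  intro u v hu hv hn
  rcases List.eq_nil_or_concat' u with rfl | ⟨w, i, rfl⟩ <;>
    rcases List.eq_nil_or_concat' v with rfl | ⟨w', j, rfl⟩
  · rw [wordDist_self, loopSum, Finset.sum_eq_zero fun x _ => τ.cycleDist_of_eq rfl]
    exact Nat.cast_zero.le
  · by_cases hp : w' <+: []
    · obtain rfl := List.prefix_nil.1 hp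
      exact τ.wordDist_parent_le_loopSum hu hv
    · rw [wordDist_comm, loopSum_comm]
      exact shrink hv hu hp (by simp at hn ⊢; omega)
  · by_cases hp : w <+: []
    · obtain rfl := List.prefix_nil.1 hp
      rw [wordDist_comm, loopSum_comm]
      exact τ.wordDist_parent_le_loopSum hv hu
    · exact shrink hu hv hp (by simp at hn ⊢; omega)
  · by_cases hp : w <+: w' ++ [j]
    · by_cases hp' : w' <+: w ++ [i]
      · rcases List.prefix_concat_iff.1 hp with rfl | h1
        · rw [wordDist_comm, loopSum_comm]
          exact τ.wordDist_parent_le_loopSum hv hu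
        · rcases List.prefix_concat_iff.1 hp' with rfl | h2
          · exact τ.wordDist_parent_le_loopSum hu hv
          · obtain rfl : w = w' := h1.eq_of_length (le_antisymm h1.length_le h2.length_le)
            rw [τ.loopSum_eq_single (τ.parent_mem _ _ hu) fun x hx => by
              rw [τ.pos_append_singleton hx, τ.pos_append_singleton hx]]
            exact τ.wordDist_siblings_le_cycleDist hu hv
      · rw [wordDist_comm, loopSum_comm]
        exact shrink hv hu hp' (by simp at hn ⊢; omega)
    · exact shrink hu hv hp (by simp at hn ⊢; omega)

theorem dist_eq_loopSum (u v : τ.Vertex) : (τ.loopGraph.dist u v : ℝ) = τ.loopSum u.1 v.1 :=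
  le_antisymm (τ.wordDist_le_loopSum _ u.2 v.2 rfl) (τ.loopSum_le_dist u v)

/-! ### The Łukasiewicz walk and the positions on the cycles -/

/-- The value of the Łukasiewicz walk when the exploration reaches the word `v`. -/
noncomputable def walkAt (v : List ℕ) : ℤ :=
  ∑ x ∈ τ.verts with x < v, ((τ.numChildren x : ℤ) - 1)

theorem card_children {u : List ℕ} (hu : u ∈ τ.verts) :
    ({v ∈ τ.verts | v ≠ [] ∧ v.dropLast = u}).card = τ.numChildren u := by
  have : {v ∈ τ.verts | v ≠ [] ∧ v.dropLast = u}
      = (Finset.Icc 1 (τ.numChildren u)).image (fun j => u ++ [j]) := by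
    ext v
    simp only [Finset.mem_filter, Finset.mem_image, Finset.mem_Icc]
    constructor
    · rintro ⟨h1, h2, h3⟩
      rcases List.eq_nil_or_concat' v with rfl | ⟨w, j, rfl⟩
      · exact absurd rfl h2
      · rw [List.dropLast_concat] at h3
        subst h3
        exact ⟨j, (τ.child_mem_iff hu j).1 h1, rfl⟩
    · rintro ⟨j, hj, rfl⟩
      exact ⟨(τ.child_mem_iff hu j).2 hj, by simp, by simp⟩
  rw [this, Finset.card_image_of_injective _ fun i j h => by simpa using h, Nat.card_Icc]
  simp

/-- The increments of the walk along a subtree add up to `-1`, because every vertex of the subtree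
except its root is the child of exactly one vertex of it. -/
theorem sum_subtree {c : List ℕ} (hc : c ∈ τ.verts) :
    ∑ x ∈ τ.verts with c <+: x, ((τ.numChildren x : ℤ) - 1) = -1 := by
  set S : Finset (List ℕ) := {x ∈ τ.verts | c <+: x} with hS
  have hcS : c ∈ S := by simp [hS, hc]
  have h1 : (S.erase c).card = ∑ x ∈ S, τ.numChildren x := by
    rw [Finset.card_eq_sum_card_fiberwise (f := List.dropLast) (t := S)]
    · refine Finset.sum_congr rfl fun x hx => ?_
      obtain ⟨hxv, hcx⟩ := Finset.mem_filter.1 hx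
      rw [← τ.card_children hxv]
      congr 1
      ext v
      simp only [hS, Finset.mem_filter, Finset.mem_erase]
      constructor
      · rintro ⟨⟨h2, h3, h4⟩, h5⟩
        refine ⟨h3, fun h6 => h2 ?_, h5⟩
        rw [h6] at h4 ⊢
        exact (List.prefix_nil.1 h4).symm
      · rintro ⟨h2, h3, h4⟩
        rcases List.eq_nil_or_concat' v with rfl | ⟨w, j, rfl⟩
        · exact absurd rfl h3
        · rw [List.dropLast_concat] at h4 ⊢
          subst h4
          refine ⟨⟨fun h5 => ?_, h2, List.prefix_append_of_prefix hcx⟩, rfl⟩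
          have := hcx.length_le
          rw [← h5] at this
          simp at this
    · intro v hv
      simp only [hS, Finset.coe_erase, Set.mem_sdiff, Finset.mem_coe, Finset.mem_filter,
        Set.mem_singleton_iff] at hv ⊢
      obtain ⟨⟨h2, h3⟩, h4⟩ := hv
      rcases List.eq_nil_or_concat' v with rfl | ⟨w, j, rfl⟩
      · exact absurd (List.prefix_nil.1 h3).symm h4
      · rw [List.dropLast_concat]
        refine ⟨τ.parent_mem _ _ h2, ?_⟩
        rcases List.prefix_concat_iff.1 h3 with h5 | h5
        · exact absurd h5.symm h4
        · exact h5
  rw [Finset.card_erase_of_mem hcS] at h1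
  have h2 : 0 < S.card := Finset.card_pos.2 ⟨c, hcS⟩
  rw [Finset.sum_sub_distrib, ← Nat.cast_sum, ← h1]
  simp
  omega

/-- The child `w ++ [1]` is explored just after `w`, and between two consecutive children the
exploration visits exactly the subtree of the first one. -/
theorem walkAt_append_singleton {w : List ℕ} (hw : w ∈ τ.verts) :
    ∀ j, 1 ≤ j → j ≤ τ.numChildren w →
      τ.walkAt (w ++ [j]) = τ.walkAt w + τ.numChildren w - j := by
  have hzero : w ++ [0] ∉ τ.verts := fun h => by
    have := (τ.letter_bounds h).1
    omega
  have h0 : τ.walkAt (w ++ [0]) = τ.walkAt w + τ.numChildren w - 1 := by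
    have : {x ∈ τ.verts | x < w ++ [0]} = insert w {x ∈ τ.verts | x < w} := by
      ext x
      simp only [Finset.mem_filter, Finset.mem_insert, lt_append_zero_iff]
      constructor
      · rintro ⟨h1, h2 | h2⟩
        · exact Or.inr ⟨h1, h2⟩
        · exact Or.inl h2
      · rintro (rfl | h2)
        · exact ⟨hw, Or.inr rfl⟩
        · exact ⟨h2.1, Or.inl h2.2⟩
    rw [walkAt, this, Finset.sum_insert (by simp), walkAt]
    ring
  have hsucc : ∀ j, τ.walkAt (w ++ [j + 1]) = τ.walkAt (w ++ [j])
      + ∑ x ∈ τ.verts with w ++ [j] <+: x, ((τ.numChildren x : ℤ) - 1) := by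
    intro j
    have : {x ∈ τ.verts | x < w ++ [j + 1]} = {x ∈ τ.verts | x < w ++ [j]} ∪
        {x ∈ τ.verts | w ++ [j] <+: x} := by
      ext x
      simp only [Finset.mem_filter, Finset.mem_union, lt_append_succ_iff]
      tauto
    rw [walkAt, this, Finset.sum_union, walkAt]
    refine Finset.disjoint_filter.2 fun x _ h1 h2 => ?_
    rcases prefix_or_lt h2 with h3 | h3
    · exact lt_asymm h1 h3
    · exact h1.ne h3.symm
  intro j hj
  induction j, hj using Nat.le_induction with
  | base =>
    intro _
    rw [hsucc 0, h0, Finset.sum_eq_zero]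
    · simp
    · intro x hx
      obtain ⟨h1, h2⟩ := Finset.mem_filter.1 hx
      exact absurd (τ.mem_of_prefix h2 h1) hzero
  | succ j hj ih =>
    intro hj'
    rw [hsucc j, ih (by omega), τ.sum_subtree ((τ.child_mem_iff hw j).2 ⟨hj, by omega⟩)]
    push_cast
    ring

theorem walkAt_le_of_prefix {c v : List ℕ} (h : c <+: v) (hv : v ∈ τ.verts) :
    τ.walkAt c ≤ τ.walkAt v := by
  obtain ⟨s, rfl⟩ := h
  induction s using List.reverseRecOn with
  | nil => simp
  | append_singleton s j ih =>
    rw [← List.append_assoc] at hv ⊢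
    have hp := τ.parent_mem _ _ hv
    have hj := (τ.child_mem_iff hp j).1 hv
    rw [τ.walkAt_append_singleton hp j hj.1 hj.2]
    have := ih hp
    have := hj.2
    omega

theorem walkAt_nil : τ.walkAt [] = 0 := by
  rw [walkAt, Finset.filter_false_of_mem fun x _ => List.not_lt_nil x, Finset.sum_empty]

theorem walkAt_nonneg {v : List ℕ} (hv : v ∈ τ.verts) : 0 ≤ τ.walkAt v := by
  rw [← walkAt_nil]
  exact τ.walkAt_le_of_prefix List.nil_prefix hv

/-- The position of `v` on the cycle of an ancestor exceeds by one the number of siblings still to be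
explored there, whence the additional term, the generation of `v`. -/
theorem sum_pos {v : List ℕ} (hv : v ∈ τ.verts) :
    ∑ w ∈ τ.verts, τ.pos w v = τ.walkAt v + v.length := by
  induction v using List.reverseRecOn with
  | nil =>
    rw [walkAt_nil, Finset.sum_eq_zero]
    · simp
    · intro w _
      rcases τ.pos_cases hv w with h | ⟨j, r, h, -⟩
      · exact h
      · simp at h
  | append_singleton w j ih =>
    have hw := τ.parent_mem _ _ hv
    have hj := (τ.child_mem_iff hw j).1 hv
    have h1 : ∀ x ∈ τ.verts, τ.pos x (w ++ [j])
        = τ.pos x w + if x = w then (τ.numChildren w : ℤ) + 1 - j else 0 := by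
      intro x _
      split_ifs with h
      · rw [h, pos_self, zero_add, τ.pos_append_cons _ _ hj.1]
      · rw [add_zero, τ.pos_append_singleton h]
    rw [Finset.sum_congr rfl h1, Finset.sum_add_distrib, ih hw, Finset.sum_ite_eq', if_pos hw,
      τ.walkAt_append_singleton hw j hj.1 hj.2]
    simp
    ring

/-- While the exploration has not passed `v`, the walk started from `w` stays above the
position of `v` on the cycle of `w`. -/
theorem pos_le_max_walkAt {w x v : List ℕ} (hw : w ∈ τ.verts) (hx : x ∈ τ.verts)
    (hv : v ∈ τ.verts) (hwx : w < x) (hxv : ¬ v < x) :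
    τ.pos w v ≤ max (τ.walkAt x - τ.walkAt w + 1) 0 := by
  rcases τ.pos_cases hv w with h | ⟨j, r, rfl, hj, hj', h⟩
  · rw [h]; exact le_max_right _ _
  · refine le_trans ?_ (le_max_left _ _)
    obtain ⟨s, rfl⟩ := prefix_of_between hwx hxv
    cases s with
    | nil => simp at hwx
    | cons i s =>
      have hi := τ.letter_bounds hx
      have hij : i ≤ j := by
        by_contra! hlt
        exact hxv (append_cons_lt hlt)
      have h1 : w ++ [i] <+: w ++ i :: s := ⟨s, by simp⟩
      have h2 := τ.walkAt_le_of_prefix h1 hx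
      rw [τ.walkAt_append_singleton hw i hi.1 hi.2] at h2
      rw [h]
      omega

/-- The bound of `pos_le_max_walkAt` is attained. -/
theorem exists_max_walkAt_le_pos {w v : List ℕ} (hw : w ∈ τ.verts) (hv : v ∈ τ.verts)
    (hwv : w < v) : ∃ x ∈ τ.verts, w < x ∧ ¬ v < x ∧
      max (τ.walkAt x - τ.walkAt w + 1) 0 ≤ τ.pos w v := by
  by_cases hp : w <+: v
  · obtain ⟨s, rfl⟩ := hp
    cases s with
    | nil => simp at hwv
    | cons j s =>
      have hj := τ.letter_bounds hv
      have h1 : w ++ [j] <+: w ++ j :: s := ⟨s, by simp⟩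
      refine ⟨w ++ [j], τ.mem_of_prefix h1 hv, ?_, ?_, ?_⟩
      · rcases prefix_or_lt (⟨[j], rfl⟩ : w <+: w ++ [j]) with h | h
        · exact h
        · simp at h
      · rcases prefix_or_lt h1 with h | h
        · exact lt_asymm h
        · rw [← h]; exact lt_irrefl _
      · rw [τ.pos_append_cons _ _ hj.1, τ.walkAt_append_singleton hw j hj.1 hj.2]
        have := hj.2
        exact max_le (by omega) (by omega)
  · obtain ⟨c, i, j, w', v', hij, rfl, rfl⟩ := exists_branching hwv hp
    have hi := τ.letter_bounds hw
    have hj := τ.letter_bounds hv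
    have h1 : c ++ [j] <+: c ++ j :: v' := ⟨v', by simp⟩
    have h2 : c ++ [i] <+: c ++ i :: w' := ⟨w', by simp⟩
    have hx := τ.mem_of_prefix h1 hv
    have hc := τ.parent_mem _ _ hx
    refine ⟨c ++ [j], hx, append_cons_lt hij, ?_, ?_⟩
    · rcases prefix_or_lt h1 with h | h
      · exact lt_asymm h
      · rw [← h]; exact lt_irrefl _
    · have h3 := τ.walkAt_le_of_prefix h2 hw
      rw [τ.walkAt_append_singleton hc i hi.1 hi.2] at h3
      rw [τ.walkAt_append_singleton hc j hj.1 hj.2, τ.pos_of_not_prefix hp]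
      exact max_le (by omega) le_rfl

/-! ### Indexing by the depth-first exploration -/

theorem dfs_mem (i : Fin τ.size) : τ.dfs i ∈ τ.verts := Finset.orderEmbOfFin_mem _ _ _

theorem dfs_lt_dfs {i j : Fin τ.size} : τ.dfs i < τ.dfs j ↔ i < j :=
  (τ.verts.orderEmbOfFin rfl).lt_iff_lt

theorem exists_dfs_eq {v : List ℕ} (hv : v ∈ τ.verts) : ∃ i, τ.dfs i = v := by
  have : v ∈ Set.range (τ.verts.orderEmbOfFin rfl) := by
    rw [Finset.range_orderEmbOfFin]; exact hv
  exact this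

theorem dfs_injective : Function.Injective τ.dfs := (τ.verts.orderEmbOfFin rfl).injective

theorem sum_dfs {M : Type*} [AddCommMonoid M] (g : List ℕ → M) :
    ∑ i, g (τ.dfs i) = ∑ v ∈ τ.verts, g v :=
  Finset.sum_bij (fun i _ => τ.dfs i) (fun i _ => τ.dfs_mem i)
    (fun _ _ _ _ h => τ.dfs_injective h)
    (fun _ hv => (τ.exists_dfs_eq hv).imp fun i hi => ⟨Finset.mem_univ i, hi⟩) (fun _ _ => rfl)

theorem size_pos : 0 < τ.size := Finset.card_pos.2 ⟨_, τ.nil_mem⟩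

theorem lukasiewicz_eq_walkAt (i : Fin τ.size) : τ.lukasiewicz i = τ.walkAt (τ.dfs i) := by
  rw [walkAt, Finset.sum_filter, ← τ.sum_dfs, lukasiewicz]
  simp only [τ.dfs_lt_dfs, Fin.lt_def]

theorem lukasiewicz_size : τ.lukasiewicz τ.size = -1 := by
  have h := τ.sum_subtree τ.nil_mem
  rw [Finset.filter_true_of_mem fun x _ => List.nil_prefix, ← τ.sum_dfs] at h
  rw [lukasiewicz, ← h]
  exact Finset.sum_congr rfl fun j _ => if_pos j.2

theorem lukasiewicz_zero : τ.lukasiewicz 0 = 0 := by simp [lukasiewicz]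

theorem lukasiewicz_succ (i : Fin τ.size) :
    τ.lukasiewicz (i + 1) = τ.lukasiewicz i + (τ.numChildren (τ.dfs i) - 1) := by
  have h : ∀ j : Fin τ.size,
      (if (j : ℕ) < i + 1 then (τ.numChildren (τ.dfs j) : ℤ) - 1 else 0)
        = (if (j : ℕ) < i then (τ.numChildren (τ.dfs j) : ℤ) - 1 else 0)
          + if j = i then (τ.numChildren (τ.dfs j) : ℤ) - 1 else 0 := by
    intro j
    rcases lt_trichotomy j i with h | h | h
    · rw [if_pos (by omega), if_pos (by omega), if_neg (by omega), add_zero]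
    · rw [if_pos (by omega), if_neg (by omega), if_pos h, zero_add]
    · rw [if_neg (by omega), if_neg (by omega), if_neg (by omega), add_zero]
  rw [lukasiewicz, Finset.sum_congr rfl fun j _ => h j, Finset.sum_add_distrib,
    Finset.sum_ite_eq' Finset.univ i, if_pos (Finset.mem_univ i)]
  rfl

/-- The word visited at step `i` of the exploration; the exploration ends at the root. -/
def wordAt (i : ℕ) : List ℕ := if h : i < τ.size then τ.dfs ⟨i, h⟩ else []

theorem wordAt_mem (i : ℕ) : τ.wordAt i ∈ τ.verts := by
  rw [wordAt]
  split_ifs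
  · exact τ.dfs_mem _
  · exact τ.nil_mem

theorem wordAt_of_lt (i : Fin τ.size) : τ.wordAt i = τ.dfs i := dif_pos i.2

theorem wordAt_size : τ.wordAt τ.size = [] := dif_neg (lt_irrefl _)

/-- The vertex visited at step `i` of the exploration. -/
def vertexAt (i : ℕ) : τ.Vertex := ⟨τ.wordAt i, τ.wordAt_mem i⟩

/-- The position of the `i`-th vertex on the cycle of the `w`-th one. -/
noncomputable def posAt (w : Fin τ.size) (i : ℕ) : ℤ := τ.pos (τ.dfs w) (τ.wordAt i)

theorem posAt_nonneg (w : Fin τ.size) (i : ℕ) : 0 ≤ τ.posAt w i := τ.pos_nonneg (τ.wordAt_mem i) _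

theorem posAt_le (w : Fin τ.size) (i : ℕ) : τ.posAt w i ≤ τ.numChildren (τ.dfs w) + 1 :=
  τ.pos_le (τ.wordAt_mem i) _

theorem posAt_size (w : Fin τ.size) : τ.posAt w τ.size = 0 := by
  rw [posAt, wordAt_size]
  by_cases h : τ.dfs w <+: []
  · rw [List.prefix_nil.1 h, pos_self]
  · exact τ.pos_of_not_prefix h

theorem dist_vertexAt (i j : ℕ) : (τ.loopGraph.dist (τ.vertexAt i) (τ.vertexAt j) : ℝ) =
    ∑ w, cyc (τ.numChildren (τ.dfs w) + 1) (τ.posAt w i) (τ.posAt w j) := by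
  rw [dist_eq_loopSum, loopSum, ← τ.sum_dfs]
  rfl

theorem posAt_of_le {w : Fin τ.size} {i : ℕ} (h : i ≤ w) : τ.posAt w i = 0 := by
  have hi := h.trans_lt w.2
  rw [posAt, show τ.wordAt i = _ from τ.wordAt_of_lt ⟨i, hi⟩]
  by_cases hp : τ.dfs w <+: τ.dfs ⟨i, hi⟩
  · rcases prefix_or_lt hp with h1 | h1
    · exact absurd (τ.dfs_lt_dfs.1 h1) (not_lt.2 h)
    · rw [← h1, pos_self]
  · exact τ.pos_of_not_prefix hp

/-- The positions are the running minima of the Łukasiewicz walk: upper bound. -/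
theorem posAt_le_max_lukasiewicz {w : Fin τ.size} {m i : ℕ} (hm : (w : ℕ) < m) (hmi : m ≤ i)
    (hi : i ≤ τ.size) :
    τ.posAt w i ≤ max (τ.lukasiewicz m - τ.lukasiewicz w + 1) 0 := by
  rcases hi.eq_or_lt with rfl | hi
  · rw [posAt_size]; exact le_max_right _ _
  · have h1 := τ.lukasiewicz_eq_walkAt ⟨m, hmi.trans_lt hi⟩
    rw [lukasiewicz_eq_walkAt, show τ.lukasiewicz m = _ from h1, posAt,
      show τ.wordAt i = _ from τ.wordAt_of_lt ⟨i, hi⟩]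
    exact τ.pos_le_max_walkAt (τ.dfs_mem _) (τ.dfs_mem _) (τ.dfs_mem _) (τ.dfs_lt_dfs.2 hm)
      (fun h => absurd (τ.dfs_lt_dfs.1 h) (not_lt.2 hmi))

/-- The positions are the running minima of the Łukasiewicz walk: the minimum is attained. -/
theorem exists_max_lukasiewicz_le_posAt {w : Fin τ.size} {i : ℕ} (hwi : (w : ℕ) < i)
    (hi : i ≤ τ.size) : ∃ m, (w : ℕ) < m ∧ m ≤ i ∧
      max (τ.lukasiewicz m - τ.lukasiewicz w + 1) 0 ≤ τ.posAt w i := by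
  rcases hi.eq_or_lt with rfl | hi
  · refine ⟨τ.size, hwi, le_rfl, ?_⟩
    have := τ.walkAt_nonneg (τ.dfs_mem w)
    rw [posAt_size, lukasiewicz_size, lukasiewicz_eq_walkAt]
    exact max_le (by omega) le_rfl
  · obtain ⟨x, hx, h1, h2, h3⟩ := τ.exists_max_walkAt_le_pos (τ.dfs_mem w)
      (τ.dfs_mem ⟨i, hi⟩) (τ.dfs_lt_dfs.2 hwi)
    obtain ⟨m, rfl⟩ := τ.exists_dfs_eq hx
    refine ⟨m, τ.dfs_lt_dfs.1 h1, not_lt.1 fun h => h2 (τ.dfs_lt_dfs.2 h), ?_⟩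
    rw [lukasiewicz_eq_walkAt, lukasiewicz_eq_walkAt, posAt,
      show τ.wordAt i = _ from τ.wordAt_of_lt ⟨i, hi⟩]
    exact h3

/-- The sum of all positions is the Łukasiewicz walk plus the generation, up to one unit at the
end of the exploration. -/
theorem sum_posAt_le {i : ℕ} (hi : i ≤ τ.size) :
    ∑ w, τ.posAt w i ≤ τ.lukasiewicz i + τ.height + 1 := by
  rcases hi.eq_or_lt with rfl | hi
  · simp only [posAt_size, Finset.sum_const_zero, lukasiewicz_size]
    omega
  · have h1 := τ.sum_pos (τ.dfs_mem ⟨i, hi⟩)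
    have h2 : (τ.dfs ⟨i, hi⟩).length ≤ τ.height := Finset.le_sup (τ.dfs_mem _)
    rw [← τ.lukasiewicz_eq_walkAt, ← τ.sum_dfs] at h1
    have h3 : ∑ w, τ.posAt w i = ∑ w, τ.pos (τ.dfs w) (τ.dfs ⟨i, hi⟩) :=
      Finset.sum_congr rfl fun w _ => by
        rw [posAt, show τ.wordAt i = _ from τ.wordAt_of_lt ⟨i, hi⟩]
    rw [h3, h1]
    simp only
    omega

end PlaneTree

/-! ### Uniform smallness of the contribution of small loops -/

namespace IsExcursion

variable {f : unitInterval → ℝ}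

theorem hasSum_relPos (hf : LoopTree.IsPJG f) (t : unitInterval) :
    HasSum (fun r => relPos f r t) (f t) := by
  refine (hasSum_subtype_iff_of_support_subset (s := {r | Anc f r t}) ?_).1 (hf t)
  intro r hr
  by_contra h
  exact hr (relPos_eq_zero h)

theorem relPos_le_of_le (hf : IsExcursion f) {r s t : unitInterval} (hrs : r ≤ s) (hst : s ≤ t) :
    relPos f r t ≤ relPos f r s := by
  simp only [relPos, hrs, hrs.trans hst, if_true]
  exact max_le_max_right 0 (by linarith [hf.infOn_mono hrs le_rfl hst])

theorem relPos_one (hf : IsExcursion f) (r : unitInterval) : relPos f r 1 = 0 := by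
  have h1 := hf.infOn_le (s := r) (t := 1) unitInterval.le_one' le_rfl
  rw [hf.map_one] at h1
  simp only [relPos, unitInterval.le_one', if_true]
  exact max_eq_right (by linarith [hf.leftVal_nonneg r])

/-- Right-continuity of positions; only the lower bound is needed. -/
theorem eventually_relPos_right (hf : IsExcursion f) (r t : unitInterval) {κ : ℝ} (hκ : 0 < κ) :
    ∀ᶠ s in 𝓝[≥] t, relPos f r t ≤ relPos f r s + κ := by
  rcases lt_or_ge t r with hr | hr
  · refine Eventually.of_forall fun s => ?_
    have : relPos f r t = 0 := by simp [relPos, not_le.2 hr]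
    linarith [relPos_nonneg (f := f) r s]
  have h1 : ∀ᶠ s in 𝓝[≥] t, |f s - f t| < κ := by
    simpa only [Real.dist_eq] using (Metric.tendsto_nhds.1 (hf.rightCts t)) κ hκ
  rcases eq_or_lt_of_le (unitInterval.le_one' (t := t)) with ht | ht
  · filter_upwards [self_mem_nhdsWithin] with s hs
    have : s = t := le_antisymm (ht ▸ unitInterval.le_one') hs
    rw [this]; linarith
  · obtain ⟨b, hb, hbs⟩ := (mem_nhdsGE_iff_exists_Ico_subset' ht).1 h1
    filter_upwards [Ico_mem_nhdsGE hb] with s hs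
    have h2 : f t - κ ≤ infOn f t s := le_infOn hs.1 fun u hu hu' => by
      have := abs_lt.1 (show |f u - f t| < κ from hbs ⟨hu, hu'.trans_lt hs.2⟩)
      linarith
    have h3 : infOn f r t ≤ f t := hf.infOn_le hr le_rfl
    have h4 : infOn f r t - κ ≤ infOn f r s := by
      rw [hf.infOn_split hr hs.1]
      exact le_min (by linarith) (by linarith)
    simp only [relPos, hr, hr.trans hs.1, if_true]
    refine max_le ?_ ?_
    · linarith [le_max_left (infOn f r s - leftVal f r) 0]
    · linarith [le_max_right (infOn f r s - leftVal f r) 0]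

/-- The part of `f` that is not explained by finitely many loops is upper semicontinuous: its
possible jumps are the jumps of `f` at the other times. -/
theorem eventually_sub_sum_relPos_lt (hf : IsExcursion f) (F : Finset unitInterval)
    (t : unitInterval) {η : ℝ} (h : f t - ∑ r ∈ F, relPos f r t < η) :
    ∀ᶠ s in 𝓝 t, f s - ∑ r ∈ F, relPos f r s < η := by
  set c := η - (f t - ∑ r ∈ F, relPos f r t) with hc
  have hc0 : 0 < c := by linarith
  rw [← nhdsLT_sup_nhdsGE, eventually_sup]
  constructor
  · rcases eq_or_lt_of_le (unitInterval.nonneg' (t := t)) with ht | ht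
    · filter_upwards [self_mem_nhdsWithin] with s hs
      exact absurd (lt_of_lt_of_le hs ht.ge) (not_lt.2 unitInterval.nonneg')
    have h1 : ∀ᶠ s in 𝓝[<] t, f s < leftVal f t + c :=
      (hf.tendsto_leftVal ht).2.eventually (gt_mem_nhds (by linarith))
    have h2 : ∀ᶠ s in 𝓝[<] t, ∀ r ∈ F, r < t → r ≤ s := by
      refine (Finset.eventually_all F).2 fun r _ => ?_
      by_cases hr : r < t
      · filter_upwards [Ioo_mem_nhdsLT hr] with s hs _ using hs.1.le
      · exact Eventually.of_forall fun s h' => absurd h' hr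
    filter_upwards [h1, h2, self_mem_nhdsWithin] with s hs1 hs2 hs3
    have hst : s < t := hs3
    have h3 : ∀ r ∈ F, relPos f r t - (if r = t then jump f t else 0) ≤ relPos f r s := by
      intro r hr
      rcases lt_trichotomy r t with h4 | h4 | h4
      · rw [if_neg h4.ne, sub_zero]
        exact hf.relPos_le_of_le (hs2 r hr h4) hst.le
      · rw [if_pos h4, h4, hf.relPos_self, sub_self]
        exact relPos_nonneg _ _
      · rw [if_neg h4.ne', sub_zero]
        have : relPos f r t = 0 := by simp [relPos, not_le.2 h4]
        rw [this]
        exact relPos_nonneg _ _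
    have h4 := Finset.sum_le_sum h3
    rw [Finset.sum_sub_distrib, Finset.sum_ite_eq'] at h4
    have h5 : (if t ∈ F then jump f t else 0) ≤ jump f t := by
      split_ifs
      · exact le_rfl
      · exact hf.jump_nonneg t
    have h6 : jump f t = f t - leftVal f t := rfl
    linarith
  · have hκ : 0 < c / (2 * (F.card + 1)) := by positivity
    have h1 : ∀ᶠ s in 𝓝[≥] t, f s < f t + c / 2 :=
      (hf.rightCts t).eventually (gt_mem_nhds (by linarith))
    have h2 : ∀ᶠ s in 𝓝[≥] t, ∀ r ∈ F, relPos f r t ≤ relPos f r s + c / (2 * (F.card + 1)) :=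
      (Finset.eventually_all F).2 fun r _ => hf.eventually_relPos_right r t hκ
    filter_upwards [h1, h2] with s hs1 hs2
    have h3 := Finset.sum_le_sum hs2
    rw [Finset.sum_add_distrib, Finset.sum_const, nsmul_eq_mul] at h3
    have h4 : (F.card : ℝ) * (c / (2 * (F.card + 1))) ≤ c / 2 := by
      rw [mul_div_assoc', div_le_div_iff₀ (by positivity) (by norm_num)]
      nlinarith
    linarith

/-- Finitely many loops explain the excursion up to `η`, uniformly in time: a version of Dini's
theorem. -/
theorem exists_finset_sub_sum_relPos_lt (hf : IsExcursion f) (hp : IsPJG f) {η : ℝ} (hη : 0 < η) :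
    ∃ F : Finset unitInterval, (∀ r ∈ F, 0 < jump f r) ∧
      ∀ t, f t - ∑ r ∈ F, relPos f r t < η := by
  classical
  obtain ⟨F, hF⟩ : ∃ F : Finset unitInterval, ∀ t ∈ (Set.univ : Set unitInterval),
      f t - ∑ r ∈ F, relPos f r t < η := by
    refine isCompact_univ.induction_on
      (p := fun S => ∃ F : Finset unitInterval, ∀ t ∈ S, f t - ∑ r ∈ F, relPos f r t < η)
      ⟨∅, by simp⟩ (fun S S' h ⟨F, hF⟩ => ⟨F, fun t ht => hF t (h ht)⟩) ?_ ?_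
    · have hmono : ∀ (F F' : Finset unitInterval) t, F ⊆ F' →
          ∑ r ∈ F, relPos f r t ≤ ∑ r ∈ F', relPos f r t := fun F F' t h =>
        Finset.sum_le_sum_of_subset_of_nonneg h fun r _ _ => relPos_nonneg r t
      rintro S S' ⟨F, hF⟩ ⟨F', hF'⟩
      refine ⟨F ∪ F', fun t ht => ?_⟩
      rcases ht with ht | ht
      · linarith [hF t ht, hmono F _ t (Finset.subset_union_left (s₂ := F'))]
      · linarith [hF' t ht, hmono F' _ t (Finset.subset_union_right (s₁ := F))]
    · -- near `t`, the pure jump growth at `t` and the semicontinuity give a finite set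
      intro t _
      have h1 : ∀ᶠ F in atTop, f t - η < ∑ r ∈ F, relPos f r t :=
        (hasSum_relPos hp t).eventually (lt_mem_nhds (by linarith))
      obtain ⟨F, hF⟩ := h1.exists
      refine ⟨{s | f s - ∑ r ∈ F, relPos f r s < η}, mem_nhdsWithin_of_mem_nhds
        (hf.eventually_sub_sum_relPos_lt F t (by linarith)), F, fun s hs => hs⟩
  refine ⟨F.filter (fun r => 0 < jump f r), fun r hr => (Finset.mem_filter.1 hr).2, fun t => ?_⟩
  have h1 : ∑ r ∈ F.filter (fun r => 0 < jump f r), relPos f r t = ∑ r ∈ F, relPos f r t := by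
    refine Finset.sum_filter_of_ne fun r _ hr => ?_
    exact (lt_of_le_of_ne (relPos_nonneg r t) hr.symm).trans_le (hf.relPos_le r t)
  rw [h1]
  exact hF t trivial

/-- Finitely many loops determine the looptree distance up to the height that they leave
unexplained. -/
theorem loopDist_bounds (hf : IsExcursion f) (hp : IsPJG f) (F : Finset unitInterval)
    (s t : unitInterval) :
    ∑ r ∈ F, cyc (jump f r) (relPos f r s) (relPos f r t) ≤ loopDist f s t ∧
    loopDist f s t ≤ ∑ r ∈ F, cyc (jump f r) (relPos f r s) (relPos f r t)
      + (f s - ∑ r ∈ F, relPos f r s) + (f t - ∑ r ∈ F, relPos f r t) := by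
  have h1 := (hf.summable_circle s t).hasSum
  rw [← hf.loopDist_eq] at h1
  have h2 := ((hasSum_relPos hp s).add (hasSum_relPos hp t)).sub h1
  have h3 := sum_le_hasSum F (fun r _ => hf.circle_nonneg r s t) h1
  have h4 := sum_le_hasSum F (fun r _ => sub_nonneg.2
    (cyc_le_add (K := jump f r) (relPos_nonneg r s) (relPos_nonneg r t))) h2
  rw [Finset.sum_sub_distrib, Finset.sum_add_distrib] at h4
  change ∑ r ∈ F, cyc (jump f r) (relPos f r s) (relPos f r t) ≤ _ at h3
  exact ⟨h3, by linarith⟩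

/-- The time `0` is the end of its own loop, hence codes the root. -/
theorem loopDist_zero_one (hf : IsExcursion f) : loopDist f 0 1 = 0 := by
  have hz : ∀ r, circleDist f r (relPos f r 0) (relPos f r 1) = 0 := by
    intro r
    rw [hf.relPos_one]
    rcases eq_or_lt_of_le (unitInterval.nonneg' (t := r)) with h | h
    · rw [← h, hf.relPos_self, circleDist, sub_zero, abs_of_nonneg (hf.jump_nonneg _), sub_self]
      exact min_eq_right (hf.jump_nonneg _)
    · have : relPos f r 0 = 0 := by simp [relPos, not_le.2 h]
      rw [this, hf.circleDist_self]
  rw [hf.loopDist_eq, tsum_congr hz, tsum_zero]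

theorem exists_loopDist_lt (hf : IsExcursion f) {ω : ℝ} (hω : 0 < ω) :
    ∃ θ > 0, ∀ s t : unitInterval, |(s : ℝ) - t| < θ → loopDist f s t < ω := by
  have h := CompactSpace.uniformContinuous_of_continuous
    (quotientProj_continuous hf.isPseudoDist)
  obtain ⟨θ, hθ, h⟩ := Metric.uniformContinuous_iff.1 h ω hω
  exact ⟨θ, hθ, fun s t hst => h (show dist s t < θ from hst)⟩

end IsExcursion

/-! ### Time changes on the doubled interval -/

/-- The embedding `t ↦ (t + 1) / 2` of `[0,1]` as the second half of the time interval of `Θf`. -/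
noncomputable def half (t : unitInterval) : unitInterval :=
  ⟨((t : ℝ) + 1) / 2, by linarith [t.2.1], by linarith [t.2.2]⟩

/-- A left inverse of `half`. The first half of the interval, on which `Θf` vanishes, is sent to the
time `1`, a time at which `f` and all positions vanish. -/
noncomputable def back (S : unitInterval) : unitInterval :=
  if h : 1 ≤ 2 * (S : ℝ) then ⟨2 * (S : ℝ) - 1, by linarith, by linarith [S.2.2]⟩ else 1

theorem coe_half (t : unitInterval) : (half t : ℝ) = ((t : ℝ) + 1) / 2 := rfl

theorem half_le_half {s t : unitInterval} : half s ≤ half t ↔ s ≤ t := by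
  rw [← Subtype.coe_le_coe, ← Subtype.coe_le_coe, coe_half, coe_half]
  constructor <;> intro h <;> linarith

theorem half_lt_half {s t : unitInterval} : half s < half t ↔ s < t :=
  lt_iff_lt_of_le_iff_le half_le_half

theorem back_half (t : unitInterval) : back (half t) = t := by
  have h : 1 ≤ 2 * (half t : ℝ) := by rw [coe_half]; linarith [t.2.1]
  rw [back, dif_pos h]
  ext
  simp only [coe_half]
  ring

theorem half_back {S : unitInterval} (h : 1 ≤ 2 * (S : ℝ)) : half (back S) = S := by
  rw [back, dif_pos h]
  ext
  simp only [coe_half]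
  ring

theorem half_zero_le_iff {S : unitInterval} : half 0 ≤ S ↔ 1 ≤ 2 * (S : ℝ) := by
  rw [← Subtype.coe_le_coe, coe_half, Set.Icc.coe_zero]
  constructor <;> intro h <;> linarith

theorem one_le_of_half_le {r S : unitInterval} (h : half r ≤ S) : 1 ≤ 2 * (S : ℝ) :=
  half_zero_le_iff.1 ((half_le_half.2 unitInterval.nonneg').trans h)

theorem theta_half (g : unitInterval → ℝ) (t : unitInterval) : theta g (half t) = g t := by
  have h : 1 ≤ 2 * (half t : ℝ) := by rw [coe_half]; linarith [t.2.1]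
  rw [theta, dif_pos h]
  congr 1
  ext
  simp only [coe_half]
  ring

namespace IsExcursion

variable {f : unitInterval → ℝ}

theorem theta_eq (hf : IsExcursion f) (S : unitInterval) : theta f S = f (back S) := by
  rw [theta, back]
  split_ifs
  · rfl
  · exact hf.map_one.symm

theorem relPos_back_of_lt (hf : IsExcursion f) {r S : unitInterval} (h : S < half r) :
    relPos f r (back S) = 0 := by
  by_cases hS : 1 ≤ 2 * (S : ℝ)
  · have : back S < r := by rwa [← half_lt_half, half_back hS]
    simp [relPos, not_le.2 this]
  · rw [back, dif_neg hS, hf.relPos_one]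

/-- The left limit `f(r-)`, with its convention at `0`, is a left limit of `Θf`. -/
theorem exists_theta_left (hf : IsExcursion f) (r : unitInterval) {η : ℝ} (hη : 0 < η) :
    ∃ R < half r, ∀ S, R < S → S < half r → |theta f S - leftVal f r| < η := by
  rcases eq_or_lt_of_le (unitInterval.nonneg' (t := r)) with h | h
  · subst h
    refine ⟨0, ?_, fun S _ hS => ?_⟩
    · rw [← Subtype.coe_lt_coe, coe_half]; simp
    · rw [theta, dif_neg (fun h' => absurd (half_zero_le_iff.2 h') (not_le.2 hS))]
      simpa [leftVal] using hη
  · have h1 : ∀ᶠ s in 𝓝[<] r, |f s - leftVal f r| < η := by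
      simpa only [Real.dist_eq] using (Metric.tendsto_nhds.1 (hf.tendsto_leftVal h).2) η hη
    obtain ⟨b, hb, hbs⟩ := (mem_nhdsLT_iff_exists_Ioo_subset' h).1 h1
    refine ⟨half b, half_lt_half.2 hb, fun S hS hS' => ?_⟩
    have h2 : half (back S) = S := half_back (one_le_of_half_le hS.le)
    rw [hf.theta_eq]
    rw [← h2, half_lt_half] at hS hS'
    exact hbs ⟨hS, hS'⟩

end IsExcursion

theorem exists_between_near {S T : unitInterval} (h : S < T) {δ : ℝ} (hδ : 0 < δ) :
    ∃ c, S < c ∧ c < T ∧ (T : ℝ) - δ < c := by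
  have h' : (S : ℝ) < T := h
  obtain ⟨c, hc, hc'⟩ := exists_between (max_lt h' (by linarith : (T : ℝ) - δ < T))
  exact ⟨⟨c, by linarith [le_max_left (S : ℝ) (T - δ), S.2.1], by linarith [T.2.2]⟩,
    (le_max_left (S : ℝ) (T - δ)).trans_lt hc, hc', (le_max_right (S : ℝ) (T - δ)).trans_lt hc⟩

namespace PlaneTree

variable (τ : PlaneTree)

/-- The number of steps of the exploration made at time `S` of the doubled interval. -/
noncomputable def stepAt (S : unitInterval) : ℕ := ⌊(2 * (S : ℝ) - 1) * τ.size⌋₊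

theorem stepAt_mono {S T : unitInterval} (h : S ≤ T) : τ.stepAt S ≤ τ.stepAt T := by
  have : (S : ℝ) ≤ T := h
  exact Nat.floor_mono (mul_le_mul_of_nonneg_right (by linarith) (Nat.cast_nonneg _))

theorem stepAt_half (t : unitInterval) : τ.stepAt (half t) = ⌊(t : ℝ) * τ.size⌋₊ := by
  rw [stepAt, coe_half]
  congr 2
  ring

theorem stepAt_le (S : unitInterval) : τ.stepAt S ≤ τ.size := by
  have h : (2 * (S : ℝ) - 1) * τ.size ≤ τ.size := by
    have h1 := S.2.2
    have h2 : (0 : ℝ) ≤ τ.size := Nat.cast_nonneg _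
    nlinarith
  exact (Nat.floor_mono h).trans (Nat.floor_natCast _).le

theorem theta_rescaledWalk (A : ℝ) (S : unitInterval) :
    theta (τ.rescaledWalk A) S = A⁻¹ * τ.lukasiewicz (τ.stepAt S) := by
  rw [theta]
  split_ifs with h
  · rfl
  · have : τ.stepAt S = 0 := by
      refine Nat.floor_of_nonpos (mul_nonpos_of_nonpos_of_nonneg ?_ (Nat.cast_nonneg _))
      linarith
    rw [this, lukasiewicz_zero]
    simp

variable {τ} {f : unitInterval → ℝ} {A η : ℝ} {e : unitInterval ≃o unitInterval}

/-- A jump of the limit that is large with respect to the uniform error is matched with exactly one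
step of the walk. -/
theorem exists_matching_step (hf : IsExcursion f) (hη : 0 < η)
    (he : ∀ S, |theta (τ.rescaledWalk A) S - theta f (e S)| ≤ η) {r : unitInterval}
    (hr : 4 * η < jump f r) :
    ∃ i : Fin τ.size, (2 * (e.symm (half r) : ℝ) - 1) * τ.size = i + 1 ∧
      |A⁻¹ * τ.lukasiewicz i - leftVal f r| ≤ 2 * η ∧
      |A⁻¹ * τ.lukasiewicz (i + 1) - f r| ≤ η := by
  simp only [theta_rescaledWalk] at he
  set T := e.symm (half r) with hT
  have hN : (0 : ℝ) < τ.size := Nat.cast_pos.2 τ.size_pos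
  have heT : e T = half r := e.apply_symm_apply _
  obtain ⟨R, hR, hRS⟩ := hf.exists_theta_left r hη
  have hST : e.symm R < T := e.symm.lt_iff_lt.2 hR
  have hleft : ∀ S, e.symm R < S → S < T →
      |A⁻¹ * τ.lukasiewicz (τ.stepAt S) - leftVal f r| ≤ 2 * η := by
    intro S h1 h2
    have h3 := hRS (e S) (by rwa [← e.symm_apply_lt]) (by rw [← heT]; exact e.lt_iff_lt.2 h2)
    have h4 := abs_sub_le (A⁻¹ * τ.lukasiewicz (τ.stepAt S)) (theta f (e S)) (leftVal f r)
    linarith [he S]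
  have hright : |A⁻¹ * τ.lukasiewicz (τ.stepAt T) - f r| ≤ η := by
    have := he T
    rwa [heT, theta_half] at this
  -- the walk has to jump at time `T`, as the jump of `f` exceeds the accumulated errors
  have hne : ∀ S, e.symm R < S → S < T → τ.stepAt S < τ.stepAt T := by
    intro S h1 h2
    refine lt_of_le_of_ne (τ.stepAt_mono h2.le) fun h3 => ?_
    have h4 := hleft S h1 h2
    rw [h3] at h4
    have h5 := abs_le.1 h4
    have h6 := abs_le.1 hright
    have h7 : jump f r = f r - leftVal f r := rfl
    linarith
  set j := τ.stepAt T with hj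
  have hj1 : 1 ≤ j := by
    obtain ⟨S, h1, h2, -⟩ := exists_between_near hST one_pos
    exact (Nat.zero_le _).trans_lt (hne S h1 h2)
  have hjT : (j : ℝ) ≤ (2 * (T : ℝ) - 1) * τ.size := (Nat.le_floor_iff' (by omega)).1 le_rfl
  -- the jump occurs at an integer time of the walk, hence `T` is exactly this time
  have hjT' : (2 * (T : ℝ) - 1) * τ.size = j := by
    refine le_antisymm (not_lt.1 fun hlt => ?_) hjT
    obtain ⟨S, h1, h2, h3⟩ := exists_between_near hST
      (δ := ((2 * (T : ℝ) - 1) * τ.size - j) / (2 * τ.size)) (div_pos (by linarith) (by linarith))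
    have h4 : (T : ℝ) - S < ((2 * (T : ℝ) - 1) * τ.size - j) / (2 * τ.size) := by linarith
    rw [lt_div_iff₀ (by linarith)] at h4
    have h5 : j ≤ τ.stepAt S := Nat.le_floor (by linarith)
    exact absurd h5 (not_le.2 (hne S h1 h2))
  obtain ⟨S, h1, h2, h3⟩ := exists_between_near hST (δ := 1 / (2 * τ.size)) (by positivity)
  have h4 : (T : ℝ) - S < 1 / (2 * τ.size) := by linarith
  rw [lt_div_iff₀ (by linarith)] at h4
  have h5 : j - 1 ≤ τ.stepAt S := Nat.le_floor (by push_cast [hj1]; linarith)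
  have h6 : τ.stepAt S = j - 1 := by have := hne S h1 h2; omega
  have hjN : j ≤ τ.size := τ.stepAt_le T
  refine ⟨⟨j - 1, by omega⟩, ?_, ?_, ?_⟩
  · rw [hjT']; push_cast [hj1]; ring
  · have := hleft S h1 h2
    rwa [h6] at this
  · have h7 : j - 1 + 1 = j := by omega
    simpa only [h7] using hright

/-- The rescaled positions on the cycle of a matched step are close to the positions on the
corresponding loop, uniformly in time. -/
theorem abs_posAt_sub_relPos_le (hf : IsExcursion f) (hA : 0 < A) (hη : 0 < η)
    (he : ∀ S, |theta (τ.rescaledWalk A) S - theta f (e S)| ≤ η) {r : unitInterval}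
    {i : Fin τ.size} (hi : (2 * (e.symm (half r) : ℝ) - 1) * τ.size = i + 1)
    (hL : |A⁻¹ * τ.lukasiewicz i - leftVal f r| ≤ 2 * η) (t : unitInterval) :
    |A⁻¹ * τ.posAt i ⌊(t : ℝ) * τ.size⌋₊ - relPos f r (back (e (half t)))| ≤ 3 * η + A⁻¹ := by
  simp only [theta_rescaledWalk, hf.theta_eq] at he
  have hA' : 0 < A⁻¹ := inv_pos.2 hA
  have hN : (0 : ℝ) < τ.size := Nat.cast_pos.2 τ.size_pos
  set T := e.symm (half r) with hT
  have heT : e T = half r := e.apply_symm_apply _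
  obtain ⟨hL1, hL2⟩ := abs_le.1 hL
  have hstepT : τ.stepAt T = i + 1 := by
    rw [stepAt, hi]
    exact_mod_cast Nat.floor_natCast ((i : ℕ) + 1)
  rw [← τ.stepAt_half]
  rcases lt_or_ge (half t) T with htT | htT
  · have h1 : τ.stepAt (half t) ≤ i := by
      have h2 : ((half t : unitInterval) : ℝ) < T := htT
      have h3 : (2 * (half t : ℝ) - 1) * τ.size < ((i + 1 : ℕ) : ℝ) := by
        push_cast
        rw [← hi]
        exact mul_lt_mul_of_pos_right (by linarith) hN
      exact Nat.lt_succ_iff.1 ((Nat.floor_lt' (by omega)).2 h3)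
    rw [τ.posAt_of_le h1, hf.relPos_back_of_lt (by rw [← heT]; exact e.lt_iff_lt.2 htT)]
    simp
    positivity
  · have hstep : (i : ℕ) + 1 ≤ τ.stepAt (half t) := hstepT ▸ τ.stepAt_mono htT
    have hS : half r ≤ e (half t) := by rw [← heT]; exact e.le_iff_le.2 htT
    have hback : half (back (e (half t))) = e (half t) := half_back (one_le_of_half_le hS)
    set v := back (e (half t)) with hv
    have hrv : r ≤ v := by rw [← half_le_half, hback]; exact hS
    have hrel : relPos f r v = max (infOn f r v - leftVal f r) 0 := by
      simp only [relPos, hrv, if_true]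
    have hX0 : (0 : ℝ) ≤ τ.posAt i (τ.stepAt (half t)) := by exact_mod_cast τ.posAt_nonneg i _
    refine abs_sub_le_iff.2 ⟨?_, ?_⟩
    · -- every value of `f` on `[r, v]` is approximated by a value of the walk after step `i`
      rcases hX0.eq_or_lt with h0 | h0
      · rw [← h0]
        linarith [IsExcursion.relPos_nonneg (f := f) r v]
      · have h1 : A⁻¹ * τ.posAt i (τ.stepAt (half t)) - 3 * η - A⁻¹ + leftVal f r
            ≤ infOn f r v := by
          refine IsExcursion.le_infOn hrv fun u hu hu' => ?_
          set S := e.symm (half u) with hSdef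
          have heS : e S = half u := e.apply_symm_apply _
          have h2 : T ≤ S := e.symm.le_iff_le.2 (half_le_half.2 hu)
          have h3 : S ≤ half t := by
            rw [hSdef, e.symm_apply_le, ← hback]
            exact half_le_half.2 hu'
          have h4 := abs_le.1 (he S)
          rw [heS, back_half] at h4
          have h5 := τ.posAt_le_max_lukasiewicz (w := i) (m := τ.stepAt S)
            (i := τ.stepAt (half t)) (by have := τ.stepAt_mono h2; omega) (τ.stepAt_mono h3)
            (τ.stepAt_le _)
          have h6 : (0 : ℤ) < τ.posAt i (τ.stepAt (half t)) := by exact_mod_cast h0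
          have h7 : τ.posAt i (τ.stepAt (half t))
              ≤ τ.lukasiewicz (τ.stepAt S) - τ.lukasiewicz i + 1 :=
            (le_max_iff.1 h5).resolve_right (by omega)
          have h8 : (τ.posAt i (τ.stepAt (half t)) : ℝ)
              ≤ τ.lukasiewicz (τ.stepAt S) - τ.lukasiewicz i + 1 := by exact_mod_cast h7
          have h9 := mul_le_mul_of_nonneg_left h8 hA'.le
          rw [mul_add, mul_sub, mul_one] at h9
          linarith
        linarith [le_max_left (infOn f r v - leftVal f r) 0]
    · -- the minimum of the walk is approximated by a value of `f` on `[r, v]`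
      obtain ⟨m, hm1, hm2, hm3⟩ := τ.exists_max_lukasiewicz_le_posAt (w := i)
        (i := τ.stepAt (half t)) (by omega) (τ.stepAt_le _)
      have hmN : m ≤ τ.size := hm2.trans (τ.stepAt_le _)
      have hmN' : (m : ℝ) / τ.size ≤ 1 := by
        rw [div_le_one hN]; exact_mod_cast hmN
      let x : unitInterval := ⟨(m : ℝ) / τ.size, by positivity, hmN'⟩
      have hx : (x : ℝ) * τ.size = m := by
        change (m : ℝ) / τ.size * τ.size = m
        field_simp
      have hxm : τ.stepAt (half x) = m := by rw [stepAt_half, hx, Nat.floor_natCast]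
      have h1 : T ≤ half x := by
        rw [← Subtype.coe_le_coe, coe_half]
        have h2 : (i : ℝ) + 1 ≤ m := by exact_mod_cast hm1
        rw [← hx, ← hi] at h2
        linarith [le_of_mul_le_mul_right h2 hN]
      have h2 : half x ≤ half t := by
        rw [half_le_half, ← Subtype.coe_le_coe]
        have h3 : (τ.stepAt (half t) : ℝ) ≤ (t : ℝ) * τ.size := by
          rw [stepAt_half]
          exact Nat.floor_le (mul_nonneg t.2.1 hN.le)
        have h4 : (m : ℝ) ≤ τ.stepAt (half t) := by exact_mod_cast hm2
        rw [← hx] at h4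
        exact le_of_mul_le_mul_right (h4.trans h3) hN
      have h3 : half r ≤ e (half x) := by rw [← heT]; exact e.le_iff_le.2 h1
      have h4 : half (back (e (half x))) = e (half x) := half_back (one_le_of_half_le h3)
      have h5 : infOn f r v ≤ f (back (e (half x))) := by
        refine hf.infOn_le ?_ ?_
        · rw [← half_le_half, h4]; exact h3
        · rw [← half_le_half, h4, hback]; exact e.le_iff_le.2 h2
      have h6 := abs_le.1 (he (half x))
      rw [hxm] at h6
      have h7 : (τ.lukasiewicz m : ℝ) - τ.lukasiewicz i + 1 ≤ τ.posAt i (τ.stepAt (half t)) := by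
        exact_mod_cast (le_max_left _ _).trans hm3
      have h8 := mul_le_mul_of_nonneg_left h7 hA'.le
      rw [mul_add, mul_sub, mul_one] at h8
      have h9 := mul_nonneg hA'.le hX0
      rw [hrel, sub_le_iff_le_add]
      exact max_le (by linarith) (by linarith)

end PlaneTree

/-! ### Comparison of the discrete and continuous distances -/

namespace PlaneTree

variable {τ : PlaneTree} {f : unitInterval → ℝ} {A η : ℝ} {e : unitInterval ≃o unitInterval}

/-- The large loops are compared one by one. What remains of each distance is at most the part of
the coding function that is not explained by the large loops. -/
theorem abs_dist_sub_loopDist_le (hf : IsExcursion f) (hp : IsPJG f) (hA : 0 < A) (hη : 0 < η)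
    (he : ∀ S, |theta (τ.rescaledWalk A) S - theta f (e S)| ≤ η) {F : Finset unitInterval}
    (hF : ∀ r ∈ F, 4 * η < jump f r) {ζ : ℝ} (hζ : ∀ t, f t - ∑ r ∈ F, relPos f r t ≤ ζ)
    (s t : unitInterval) :
    |A⁻¹ * τ.loopGraph.dist (τ.vertexAt ⌊(s : ℝ) * τ.size⌋₊) (τ.vertexAt ⌊(t : ℝ) * τ.size⌋₊)
        - loopDist f (back (e (half s))) (back (e (half t)))|
      ≤ F.card * (15 * η + 6 * A⁻¹) + 2 * ζ + 2 * η + 2 * (A⁻¹ * (τ.height + 1)) := by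
  classical
  have hA' : 0 < A⁻¹ := inv_pos.2 hA
  have : Nonempty (Fin τ.size) := ⟨⟨0, τ.size_pos⟩⟩
  choose! w hw1 hw2 hw3 using fun r (hr : r ∈ F) => exists_matching_step hf hη he (hF r hr)
  -- a step determines its time, hence distinct loops are matched with distinct steps
  have hinj : Set.InjOn w F := by
    intro r hr r' hr' h
    have h1 := hw1 r hr
    rw [h, ← hw1 r' hr'] at h1
    have h2 := mul_right_cancel₀ (Nat.cast_ne_zero.2 τ.size_pos.ne') h1
    have h3 : e.symm (half r) = e.symm (half r') := Subtype.ext (by linarith)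
    rw [← back_half r, ← back_half r', e.symm.injective h3]
  set s' := back (e (half s)) with hs'
  set t' := back (e (half t)) with ht'
  set X : unitInterval → Fin τ.size → ℝ := fun u v => A⁻¹ * τ.posAt v ⌊(u : ℝ) * τ.size⌋₊ with hX
  set K : Fin τ.size → ℝ := fun v => A⁻¹ * (τ.numChildren (τ.dfs v) + 1) with hK
  have hX0 : ∀ u v, 0 ≤ X u v := fun u v =>
    mul_nonneg hA'.le (by exact_mod_cast τ.posAt_nonneg v _)
  have hXK : ∀ u v, X u v ≤ K v := fun u v =>
    mul_le_mul_of_nonneg_left (by exact_mod_cast τ.posAt_le v _) hA'.le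
  have hclose : ∀ u, ∀ r ∈ F, |X u (w r) - relPos f r (back (e (half u)))| ≤ 3 * η + A⁻¹ :=
    fun u r hr => abs_posAt_sub_relPos_le hf hA hη he (hw1 r hr) (hw2 r hr) u
  have hKclose : ∀ r ∈ F, |K (w r) - jump f r| ≤ 3 * η + 2 * A⁻¹ := by
    intro r hr
    have h1 : (τ.lukasiewicz (w r + 1) : ℝ) = τ.lukasiewicz (w r)
        + (τ.numChildren (τ.dfs (w r)) - 1) := by
      exact_mod_cast τ.lukasiewicz_succ (w r)
    have h2 : K (w r) = A⁻¹ * τ.lukasiewicz (w r + 1) - A⁻¹ * τ.lukasiewicz (w r)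
        + 2 * A⁻¹ := by
      rw [h1, hK]; ring
    have h3 : jump f r = f r - leftVal f r := rfl
    have h4 := abs_le.1 (hw2 r hr)
    have h5 := abs_le.1 (hw3 r hr)
    rw [h2, h3, abs_le]
    constructor <;> linarith
  -- the total of the positions is the height of the walk
  have hsum : ∀ u, ∑ v, X u v ≤ f (back (e (half u))) + η + A⁻¹ * (τ.height + 1) := by
    intro u
    have h1 := he (half u)
    rw [theta_rescaledWalk, hf.theta_eq, stepAt_half] at h1
    have h2 : ∑ v, (τ.posAt v ⌊(u : ℝ) * τ.size⌋₊ : ℝ)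
        ≤ τ.lukasiewicz ⌊(u : ℝ) * τ.size⌋₊ + τ.height + 1 := by
      have h3 := τ.stepAt_le (half u)
      rw [stepAt_half] at h3
      exact_mod_cast τ.sum_posAt_le h3
    have h4 := mul_le_mul_of_nonneg_left h2 hA'.le
    rw [hX, ← Finset.mul_sum]
    have h5 := (abs_le.1 h1).2
    rw [add_assoc, mul_add] at h4
    linarith
  have hrest : ∀ u, ∑ v, X u v - ∑ r ∈ F, X u (w r)
      ≤ ζ + η + A⁻¹ * (τ.height + 1) + F.card * (3 * η + A⁻¹) := by
    intro u
    have h1 : ∑ r ∈ F, (relPos f r (back (e (half u))) - X u (w r))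
        ≤ ∑ _r ∈ F, (3 * η + A⁻¹) :=
      Finset.sum_le_sum fun r hr => by linarith [(abs_le.1 (hclose u r hr)).1]
    rw [Finset.sum_sub_distrib, Finset.sum_const, nsmul_eq_mul] at h1
    linarith [hsum u, hζ (back (e (half u)))]
  -- the discrete distance
  set D : ℝ := A⁻¹ * τ.loopGraph.dist (τ.vertexAt ⌊(s : ℝ) * τ.size⌋₊)
    (τ.vertexAt ⌊(t : ℝ) * τ.size⌋₊) with hD
  have hDsum : D = ∑ v, cyc (K v) (X s v) (X t v) := by
    rw [hD, dist_vertexAt, Finset.mul_sum]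
    exact Finset.sum_congr rfl fun v _ => (cyc_mul hA'.le _ _ _).symm
  have himg : ∀ g : Fin τ.size → ℝ, ∑ v ∈ F.image w, g v = ∑ r ∈ F, g (w r) :=
    fun g => Finset.sum_image hinj
  have hlow : ∑ r ∈ F, cyc (K (w r)) (X s (w r)) (X t (w r)) ≤ D := by
    rw [hDsum, ← himg fun v => cyc (K v) (X s v) (X t v)]
    exact Finset.sum_le_sum_of_subset_of_nonneg (Finset.subset_univ _) fun v _ _ =>
      cyc_nonneg (hX0 _ _) (hXK _ _) (hX0 _ _) (hXK _ _)
  have hup : D ≤ ∑ r ∈ F, cyc (K (w r)) (X s (w r)) (X t (w r))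
      + (∑ v, X s v - ∑ r ∈ F, X s (w r)) + (∑ v, X t v - ∑ r ∈ F, X t (w r)) := by
    have h1 : ∑ v ∈ F.image w, (X s v + X t v - cyc (K v) (X s v) (X t v))
        ≤ ∑ v, (X s v + X t v - cyc (K v) (X s v) (X t v)) :=
      Finset.sum_le_sum_of_subset_of_nonneg (Finset.subset_univ _) fun v _ _ =>
        sub_nonneg.2 (cyc_le_add (hX0 _ _) (hX0 _ _))
    rw [himg] at h1
    simp only [Finset.sum_sub_distrib, Finset.sum_add_distrib] at h1
    rw [← hDsum] at h1
    linarith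
  have hbig : |∑ r ∈ F, cyc (K (w r)) (X s (w r)) (X t (w r))
      - ∑ r ∈ F, cyc (jump f r) (relPos f r s') (relPos f r t')|
      ≤ F.card * (9 * η + 4 * A⁻¹) := by
    rw [← Finset.sum_sub_distrib]
    refine (Finset.abs_sum_le_sum_abs _ _).trans ?_
    have h1 : ∀ r ∈ F, |cyc (K (w r)) (X s (w r)) (X t (w r))
        - cyc (jump f r) (relPos f r s') (relPos f r t')| ≤ 9 * η + 4 * A⁻¹ := by
      intro r hr
      refine (abs_cyc_sub_cyc_le _ _ _ _ _ _).trans ?_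
      linarith [hKclose r hr, hclose s r hr, hclose t r hr]
    refine (Finset.sum_le_sum h1).trans ?_
    rw [Finset.sum_const, nsmul_eq_mul]
  obtain ⟨hc1, hc2⟩ := hf.loopDist_bounds hp F s' t'
  have hb := abs_le.1 hbig
  have h1 := hrest s
  have h2 := hrest t
  have h3 := hζ s'
  have h4 := hζ t'
  have h5 : (0 : ℝ) ≤ F.card * (3 * η + A⁻¹) := by positivity
  have h6 : (0 : ℝ) ≤ A⁻¹ * (τ.height + 1) := by positivity
  rw [abs_le]
  constructor <;> linarith

end PlaneTree

/-- The time change moves the points of the looptree by a small distance. The points sent to the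
first half of the interval are close to `0`, which is the root of the looptree. -/
theorem IsExcursion.exists_loopDist_back_lt {f : unitInterval → ℝ} (hf : IsExcursion f) {ω : ℝ}
    (hω : 0 < ω) : ∃ θ > 0, ∀ e : unitInterval ≃o unitInterval,
      (∀ S, |(e S : ℝ) - S| ≤ θ) → ∀ t, loopDist f t (back (e (half t))) < ω := by
  obtain ⟨θ, hθ, h⟩ := hf.exists_loopDist_lt hω
  refine ⟨θ / 4, by positivity, fun e he t => ?_⟩
  have h1 := abs_le.1 (he (half t))
  rw [coe_half] at h1
  by_cases hS : 1 ≤ 2 * (e (half t) : ℝ)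
  · refine h _ _ ?_
    rw [back, dif_pos hS, abs_lt]
    simp only
    constructor <;> linarith
  · rw [back, dif_neg hS]
    have h2 : loopDist f t 0 < ω := by
      refine h _ _ ?_
      rw [Set.Icc.coe_zero, abs_lt]
      constructor <;> linarith [t.2.1]
    have h3 := hf.loopDist_triangle t 0 1
    rw [hf.loopDist_zero_one] at h3
    linarith

/-- The distances of the rescaled discrete looptrees converge uniformly. -/
theorem eventually_abs_dist_sub_loopDist_le {τ : ℕ → PlaneTree} {f : unitInterval → ℝ}
    (hf : IsExcursion f) {a : ℕ → ℝ} (ha : ∀ n, 0 < a n) (ha_top : Tendsto a atTop atTop)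
    (h_height : Tendsto (fun n => ((τ n).height : ℝ) / a n) atTop (𝓝 0))
    (h_walk : RelaxedSkorokhodTendsto (fun n => (τ n).rescaledWalk (a n)) f)
    (h_pjg : IsPJG f) {ε : ℝ} (hε : 0 < ε) :
    ∀ᶠ n in atTop, ∀ s t : unitInterval,
      |(a n)⁻¹ * (τ n).loopGraph.dist ((τ n).vertexAt ⌊(s : ℝ) * (τ n).size⌋₊)
          ((τ n).vertexAt ⌊(t : ℝ) * (τ n).size⌋₊) - loopDist f s t| ≤ ε := by
  obtain ⟨F, hFpos, hF⟩ := hf.exists_finset_sub_sum_relPos_lt h_pjg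
    (show 0 < ε / 16 by positivity)
  obtain ⟨θ, hθ, hback⟩ := hf.exists_loopDist_back_lt (show 0 < ε / 4 by positivity)
  obtain ⟨δ, hδ, hδF⟩ : ∃ δ > 0, ∀ r ∈ F, δ ≤ jump f r := by
    rcases F.eq_empty_or_nonempty with rfl | hne
    · exact ⟨1, one_pos, by simp⟩
    · obtain ⟨r, hr, hmin⟩ := F.exists_min_image (jump f) hne
      exact ⟨jump f r, hFpos r hr, hmin⟩
  obtain ⟨η, hη, hη1, hη2, hη3⟩ : ∃ η > 0, 4 * η < δ ∧ η ≤ θ ∧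
      F.card * (15 * η) + 2 * η ≤ ε / 8 := by
    refine ⟨min (δ / 8) (min θ (ε / (8 * (15 * F.card + 2)))), by positivity, ?_, ?_, ?_⟩
    · linarith [min_le_left (δ / 8) (min θ (ε / (8 * (15 * F.card + 2))))]
    · exact (min_le_right _ _).trans (min_le_left _ _)
    · have h1 : min (δ / 8) (min θ (ε / (8 * (15 * F.card + 2))))
          ≤ ε / (8 * (15 * F.card + 2)) := (min_le_right _ _).trans (min_le_right _ _)
      rw [le_div_iff₀ (by positivity)] at h1
      linarith
  have hlim : Tendsto (fun n => F.card * (15 * η + 6 * (a n)⁻¹) + 2 * (ε / 16) + 2 * η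
      + 2 * ((τ n).height / a n + (a n)⁻¹)) atTop
      (𝓝 (F.card * (15 * η + 6 * 0) + 2 * (ε / 16) + 2 * η + 2 * (0 + 0))) := by
    have hinv := tendsto_inv_atTop_zero.comp ha_top
    exact ((((hinv.const_mul 6).const_add _).const_mul _).add_const _ |>.add_const _).add
      ((h_height.add hinv).const_mul 2)
  have hev := hlim.eventually (gt_mem_nhds (show _ < ε / 2 by linarith))
  have hsk : ∀ᶠ n in atTop, skorokhodDist (theta ((τ n).rescaledWalk (a n))) (theta f)
      < ENNReal.ofReal η :=
    Tendsto.eventually h_walk (gt_mem_nhds (ENNReal.ofReal_pos.2 hη))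
  filter_upwards [hev, hsk] with n hn hn' s t
  obtain ⟨e, he⟩ := iInf_lt_iff.1 hn'
  obtain ⟨he1, he2⟩ := max_lt_iff.1 he
  have he1' : ∀ S, |(e S : ℝ) - S| ≤ η := fun S =>
    (ENNReal.ofReal_le_ofReal_iff hη.le).1
      ((le_iSup (fun t => ENNReal.ofReal |(e t : ℝ) - t|) S).trans he1.le)
  have he2' : ∀ S, |theta ((τ n).rescaledWalk (a n)) S - theta f (e S)| ≤ η := fun S =>
    (ENNReal.ofReal_le_ofReal_iff hη.le).1
      ((le_iSup (fun t => ENNReal.ofReal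
        |theta ((τ n).rescaledWalk (a n)) t - theta f (e t)|) S).trans he2.le)
  have h1 := PlaneTree.abs_dist_sub_loopDist_le hf h_pjg (ha n) hη he2'
    (fun r hr => hη1.trans_le (hδF r hr)) (fun t => (hF t).le) s t
  have hbs := hback e (fun S => (he1' S).trans hη2) s
  have hbt := hback e (fun S => (he1' S).trans hη2) t
  set s' := back (e (half s))
  set t' := back (e (half t))
  have t1 := hf.loopDist_triangle s s' t
  have t2 := hf.loopDist_triangle s' t' t
  have t3 := hf.loopDist_triangle s' s t'
  have t4 := hf.loopDist_triangle s t t'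
  rw [hf.loopDist_comm t' t] at t2
  rw [hf.loopDist_comm s' s] at t3
  have hh : (a n)⁻¹ * ((τ n).height + 1) = (τ n).height / a n + (a n)⁻¹ := by ring
  rw [hh] at h1
  have h2 := abs_le.1 (h1.trans hn.le)
  rw [abs_le]
  constructor <;> linarith

/-! ### From uniform convergence to Gromov–Hausdorff–Prokhorov convergence -/

/-- Two spaces parametrized by the same probability space, with close distances, are close. The
correspondence is the closure of the set of pairs of points with the same parameter. -/
theorem ghpDist_le_of_parametrization {X Y : WeightedSpace} {Ω : Type*} [MeasurableSpace Ω]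
    {P : Measure Ω} [IsProbabilityMeasure P] {φ : Ω → X.carrier} {ψ : Ω → Y.carrier}
    (hφ : Measurable φ) (hψ : Measurable ψ) (hφP : P.map φ = X.mass) (hψP : P.map ψ = Y.mass)
    (hφs : Function.Surjective φ) (hψs : Function.Surjective ψ)
    (hroot : ∃ o, φ o = X.root ∧ ψ o = Y.root) {ε : ℝ}
    (h : ∀ o o', |dist (φ o) (φ o') - dist (ψ o) (ψ o')| ≤ ε) :
    ghpDist X Y ≤ ENNReal.ofReal ε := by
  set S : Set (X.carrier × Y.carrier) := Set.range fun o => (φ o, ψ o) with hS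
  have hSR : S ⊆ closure S := subset_closure
  have hm : Measurable fun o => (φ o, ψ o) := hφ.prodMk hψ
  have hR : IsCorrespondence (closure S) ∧ IsCompact (closure S) ∧
      (X.root, Y.root) ∈ closure S := by
    refine ⟨⟨fun x => ?_, fun y => ?_⟩, isClosed_closure.isCompact, ?_⟩
    · obtain ⟨o, rfl⟩ := hφs x
      exact ⟨ψ o, hSR ⟨o, rfl⟩⟩
    · obtain ⟨o, rfl⟩ := hψs y
      exact ⟨φ o, hSR ⟨o, rfl⟩⟩
    · obtain ⟨o, h1, h2⟩ := hroot
      exact hSR ⟨o, Prod.ext h1 h2⟩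
  have hν : (P.map fun o => (φ o, ψ o)).map Prod.fst = X.mass ∧
      (P.map fun o => (φ o, ψ o)).map Prod.snd = Y.mass := by
    rw [Measure.map_map measurable_fst hm, Measure.map_map measurable_snd hm]
    exact ⟨hφP, hψP⟩
  rw [ghpDist]
  refine iInf_le_of_le (closure S) ?_
  refine iInf_le_of_le (P.map fun o => (φ o, ψ o)) ?_
  refine iInf_le_of_le hR (iInf_le_of_le hν (max_le ?_ ?_))
  · refine ENNReal.half_le_self.trans (iSup₂_le fun p hp => iSup₂_le fun q hq =>
      ENNReal.ofReal_le_ofReal ?_)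
    have hcl : IsClosed {z : (X.carrier × Y.carrier) × (X.carrier × Y.carrier) |
        |dist z.1.1 z.2.1 - dist z.1.2 z.2.2| ≤ ε} :=
      isClosed_le (by fun_prop) continuous_const
    have hsub : S ×ˢ S ⊆ {z : (X.carrier × Y.carrier) × (X.carrier × Y.carrier) |
        |dist z.1.1 z.2.1 - dist z.1.2 z.2.2| ≤ ε} := by
      rintro ⟨-, -⟩ ⟨⟨o, rfl⟩, ⟨o', rfl⟩⟩
      exact h o o'
    have hpq : (p, q) ∈ closure (S ×ˢ S) := by
      rw [closure_prod_eq]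
      exact ⟨hp, hq⟩
    exact closure_minimal hsub hcl hpq
  · have h1 : 1 ≤ (P.map fun o => (φ o, ψ o)) (closure S) := by
      refine le_trans ?_ (Measure.le_map_apply hm.aemeasurable _)
      rw [show (fun o => (φ o, ψ o)) ⁻¹' closure S = Set.univ from
        Set.eq_univ_of_forall fun o => hSR ⟨o, rfl⟩, measure_univ]
    rw [tsub_eq_zero_of_le h1]
    exact zero_le

theorem map_eq_uniformOfFintype {V : Type*} [Fintype V] [Nonempty V] [MeasurableSpace V]
    [MeasurableSingletonClass V] {φ : unitInterval → V} (hφ : Measurable φ)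
    (h : ∀ v, (volume : Measure unitInterval) (φ ⁻¹' {v}) = (Fintype.card V : ℝ≥0∞)⁻¹) :
    (volume : Measure unitInterval).map φ = (PMF.uniformOfFintype V).toMeasure := by
  refine Measure.ext_of_singleton fun v => ?_
  rw [Measure.map_apply hφ (measurableSet_singleton v), h,
    PMF.toMeasure_apply_singleton _ _ (measurableSet_singleton v), PMF.uniformOfFintype_apply]

namespace PlaneTree

variable (τ : PlaneTree)

theorem floor_mul_size_lt {t : unitInterval} (ht : t ≠ 1) : ⌊(t : ℝ) * τ.size⌋₊ < τ.size := by
  have hN : (0 : ℝ) < τ.size := Nat.cast_pos.2 τ.size_pos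
  have h1 : (t : ℝ) < 1 := lt_of_le_of_ne t.2.2 fun h => ht (Subtype.ext h)
  rw [Nat.floor_lt (mul_nonneg t.2.1 hN.le)]
  nlinarith

theorem exists_vertexAt_eq (v : τ.Vertex) : ∃ i : Fin τ.size, τ.vertexAt i = v := by
  obtain ⟨i, hi⟩ := τ.exists_dfs_eq v.2
  exact ⟨i, Subtype.ext ((τ.wordAt_of_lt i).trans hi)⟩

theorem vertexAt_injective (i j : Fin τ.size) (h : τ.vertexAt i = τ.vertexAt j) : i = j := by
  have h1 : τ.wordAt i = τ.wordAt j := Subtype.ext_iff.1 h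
  rw [wordAt_of_lt, wordAt_of_lt] at h1
  exact τ.dfs_injective h1

theorem card_vertex : Fintype.card τ.Vertex = τ.size := Fintype.card_coe _

theorem volume_vertexAt_floor (v : τ.Vertex) :
    (volume : Measure unitInterval)
      ((fun t : unitInterval => τ.vertexAt ⌊(t : ℝ) * τ.size⌋₊) ⁻¹' {v})
      = (Fintype.card τ.Vertex : ℝ≥0∞)⁻¹ := by
  obtain ⟨i, rfl⟩ := τ.exists_vertexAt_eq v
  have hN : (0 : ℝ) < τ.size := Nat.cast_pos.2 τ.size_pos
  have hi : (i : ℝ) + 1 ≤ τ.size := by exact_mod_cast i.2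
  have hi0 : (0 : ℝ) ≤ i := Nat.cast_nonneg _
  let x : unitInterval := ⟨(i : ℝ) / τ.size, by positivity, by rw [div_le_one hN]; linarith⟩
  let y : unitInterval := ⟨((i : ℝ) + 1) / τ.size, by positivity, by rwa [div_le_one hN]⟩
  have hae : ((fun t : unitInterval => τ.vertexAt ⌊(t : ℝ) * τ.size⌋₊) ⁻¹' {τ.vertexAt i} :
      Set unitInterval) =ᵐ[volume] Set.Ico x y := by
    have hne : ∀ᵐ t : unitInterval, t ≠ 1 := by
      have : (volume : Measure unitInterval) {1} = 0 := by
        rw [← Set.Icc_self, unitInterval.volume_Icc]; simp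
      exact compl_mem_ae_iff.2 this
    filter_upwards [hne] with t ht
    refine propext ?_
    change τ.vertexAt ⌊(t : ℝ) * τ.size⌋₊ = τ.vertexAt i ↔ x ≤ t ∧ t < y
    have hlt := τ.floor_mul_size_lt ht
    have h1 : τ.vertexAt ⌊(t : ℝ) * τ.size⌋₊ = τ.vertexAt i ↔ ⌊(t : ℝ) * τ.size⌋₊ = i := by
      constructor
      · intro h
        exact Fin.ext_iff.1 (τ.vertexAt_injective ⟨_, hlt⟩ i h)
      · intro h
        rw [h]
    rw [h1, Nat.floor_eq_iff (mul_nonneg t.2.1 hN.le), ← Subtype.coe_le_coe,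
      ← Subtype.coe_lt_coe, div_le_iff₀ hN, lt_div_iff₀ hN]
  rw [measure_congr hae, unitInterval.volume_Ico, card_vertex]
  have : (y : ℝ) - x = (τ.size : ℝ)⁻¹ := by
    change ((i : ℝ) + 1) / τ.size - (i : ℝ) / τ.size = _
    field_simp
    ring
  rw [this, ENNReal.ofReal_inv_of_pos hN, ENNReal.ofReal_natCast]

end PlaneTree

/-- The discrete looptree, scaled by `c`, is parametrized by `[0,1]` through the depth-first
exploration run at constant speed. -/
theorem ghpDist_loop_looptree_le (τ : PlaneTree) {f : unitInterval → ℝ} (hf : IsExcursion f)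
    {c : ℝ} (hc : 0 < c) {ε : ℝ}
    (h : ∀ s t : unitInterval, |c * τ.loopGraph.dist (τ.vertexAt ⌊(s : ℝ) * τ.size⌋₊)
      (τ.vertexAt ⌊(t : ℝ) * τ.size⌋₊) - loopDist f s t| ≤ ε) :
    ghpDist (τ.loop.scale c hc) (looptree f hf) ≤ ENNReal.ofReal ε := by
  let := τ.loopMetric
  let : MeasurableSpace τ.Vertex := borel _
  have : BorelSpace τ.Vertex := ⟨rfl⟩
  have hm : Measurable fun t : unitInterval => τ.vertexAt ⌊(t : ℝ) * τ.size⌋₊ :=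
    (measurable_from_nat (f := τ.vertexAt)).comp
      (Nat.measurable_floor.comp (measurable_subtype_coe.mul_const _))
  have hN : (0 : ℝ) < τ.size := Nat.cast_pos.2 τ.size_pos
  refine ghpDist_le_of_parametrization (X := τ.loop.scale c hc) (Y := looptree f hf)
    (P := (volume : Measure unitInterval))
    (φ := fun t : unitInterval => τ.vertexAt ⌊(t : ℝ) * τ.size⌋₊)
    (ψ := quotientProj hf.isPseudoDist) hm ?_ ?_ rfl ?_ (quotientProj_surjective _) ?_ ?_
  · let : MeasurableSpace (SeparationQuotient (PreQuotient hf.isPseudoDist)) := borel _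
    have : BorelSpace (SeparationQuotient (PreQuotient hf.isPseudoDist)) := ⟨rfl⟩
    exact (quotientProj_continuous hf.isPseudoDist).measurable
  · exact map_eq_uniformOfFintype (V := τ.Vertex) hm τ.volume_vertexAt_floor
  · intro v
    obtain ⟨i, hi⟩ := τ.exists_vertexAt_eq v
    have hi' : (i : ℝ) ≤ τ.size := by exact_mod_cast i.2.le
    refine ⟨⟨(i : ℝ) / τ.size, by positivity, by rwa [div_le_one hN]⟩, ?_⟩
    simp only
    rw [div_mul_cancel₀ _ hN.ne', Nat.floor_natCast]
    exact hi
  · refine ⟨1, ?_, rfl⟩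
    simp only [Set.Icc.coe_one, one_mul, Nat.floor_natCast]
    exact Subtype.ext τ.wordAt_size
  · intro s t
    exact h s t

end LoopTree

theorem mainTheorem5 (τ : ℕ → LoopTree.PlaneTree) (f : unitInterval → ℝ)
    (hf : LoopTree.IsExcursion f) (a : ℕ → ℝ) (ha : ∀ n, 0 < a n)
    (ha_top : Tendsto a atTop atTop)
    (h_height : Tendsto (fun n => ((τ n).height : ℝ) / a n) atTop (𝓝 0))
    (h_walk : LoopTree.RelaxedSkorokhodTendsto (fun n => (τ n).rescaledWalk (a n)) f)
    (h_pjg : LoopTree.IsPJG f) :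
    LoopTree.GHPTendsto (fun n => (τ n).loop.scale (a n)⁻¹ (inv_pos.2 (ha n)))
      (LoopTree.looptree f hf) := by
  refine ENNReal.tendsto_nhds_zero.2 fun ε hε => ?_
  obtain ⟨ε', hε', hlt⟩ := ENNReal.lt_iff_exists_real_btwn.1 hε
  have hpos : 0 < ε' := ENNReal.ofReal_pos.1 hlt.1
  filter_upwards [LoopTree.eventually_abs_dist_sub_loopDist_le hf ha ha_top h_height h_walk h_pjg
    hpos] with n hn
  exact (LoopTree.ghpDist_loop_looptree_le (τ n) hf (inv_pos.2 (ha n)) hn).trans hlt.2.le
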